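/- **Setting.** A (finite-support) sub-distribution has total mass $|\gamma|\in(0,1]$, a distribution has mass $1$; $\delta_o$ is the point distribution at $o$. *Processes.* $P,Q ::= \mathsf{nil} \mid \mathsf{tick}.C \mid P\parallel Q \mid \lfloor \bar c\langle v\rangle.C\rfloor D \mid \lfloor c(x).C\rfloor D \mid s?x.C \mid a!v.C \mid \text{if } b \text{ then } P \text{ else } Q \mid P\backslash c \mid X \mid \mathsf{fix}\,X.P$, where $C,D$ are finite probabilistic choices $\bigoplus_{i\in I} p_i{:}P_i$ ($p_i>0$, $\sum_i p_i=1$), read as distributions over processes. Guards are Boolean combinations of comparisons of values; a conditional is identified with the branch that its closed guard selects. Processes are taken up to $\alpha$-conversion, are closed, and all recursions are time-guarded ($X$ occurs in $P$ only under a $\mathsf{tick}$ prefix or in the timeout branch $D$ of a communication). $s?x$ reads sensor $s$, $a!v$ writes actuator $a$. Process transitions are those of a timed CCS: $\lfloor \bar c\langle v\rangle.C\rfloor D$ and $\lfloor c(x).C\rfloor D$ either communicate (output $v$; input any value $v$, continuing with $C\{v/x\}$) or let one time unit pass and become $D$; $\mathsf{nil}$ idles; $\mathsf{tick}.C$ waits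 one time unit; parallel components interleave, synchronise on complementary channel actions (giving $\tau$), and let time pass together only if their parallel composition has no $\tau$-transition; restriction blocks the communications on $c$. *Systems.* A cyber-physical system (CPS) is either $\mathsf{Dead}$, which has no transitions, or consists of a physical environment $(\mathit{evol},\mathit{meas},\mathit{inv})$ and a physical state $(\xi_x,\xi_s,\xi_a)$ over sets of state variables, sensors and actuators, together with a process that uses only those sensors and actuators. Here $\mathit{evol}(\xi_x,\xi_a)$ is a distribution over state functions, $\mathit{meas}(\xi_x)$ one over sensor functions, and $\mathit{inv}$ a set of state functions. If $\xi_x\notin \mathit{inv}$, the only transition is $\xrightarrow{\tau}\delta_{\mathsf{Dead}}$. If $\xi_x\in \mathit{inv}$: channel outputs, channel inputs and $\tau$-moves of the process are transitions of the system; reading sensor $s$ (with value $\xi_s(s)$) and writing a real value $v$ on actuator $a$ (updating $\xi_a(a)$ to $v$) are $\tau$-transitions; and if there is no $\tau$-transition, a $\mathsf{tick}$ of the process is a $\mathsf{tick}$-transition of the system, where $\xi_x'$ is drawn from $\mathit{evol}(\xi_x,\xi_a)$, then $\xi_s'$ from $\mathit{meas}(\xi_x')$, independently of the successor process, and $\xi_a$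 is unchanged. *Weak transitions.* $M\xrightarrow{\hat\alpha}\gamma$ means $M\xrightarrow{\alpha}\gamma$ or ($\alpha=\tau$ and $\gamma=\delta_M$). For sub-distributions, $\sum_{i\in I}p_i\delta_{M_i}\xrightarrow{\hat\alpha}\sum_{j\in J}p_j\gamma_j$ (with $I$ finite and all $p_i>0$) if $\emptyset\ne J\subseteq I$, $M_j\xrightarrow{\hat\alpha}\gamma_j$ for $j\in J$, and $M_i$ has no $\hat\alpha$-transition for $i\in I\setminus J$. $\stackrel{\hat\tau}{\Longrightarrow}$ is the reflexive-transitive closure of $\xrightarrow{\hat\tau}$, and $\stackrel{\hat\alpha}{\Longrightarrow}\;=\;\stackrel{\hat\tau}{\Longrightarrow}\xrightarrow{\hat\alpha}\stackrel{\hat\tau}{\Longrightarrow}$ for $\alpha\neq\tau$. Write $N\stackrel{\hat\alpha}{\Longrightarrow}\gamma$ for $\delta_N\stackrel{\hat\alpha}{\Longrightarrow}\gamma$. *Bisimilarity.* A symmetric relation $R$ on CPSs is a weak probabilistic bisimulation if, whenever $M\,R\,N$ and $M\xrightarrow{\alpha}\gamma$, there are a distribution $\gamma'$ with $N\stackrel{\hat\alpha}{\Longrightarrow}\gamma'$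 and a coupling $\omega$ of $(\gamma,\gamma')$ such that $M'\,R\,N'$ whenever $\omega(M',N')>0$. $M\approx N$ if some such $R$ relates $M$ and $N$. *Distance.* A $[0,1]$-valued pseudometric $d$ on CPSs is a weak bisimulation metric if, whenever $d(M,N)<1$ and $M\xrightarrow{\alpha}\gamma$, there is a sub-distribution $\gamma'$ with $N\stackrel{\hat\alpha}{\Longrightarrow}\gamma'$ and $\mathbf K(d)(\gamma,\gamma'+(1-|\gamma'|)\delta_{\mathsf{Dead}})\le d(M,N)$, where $\mathbf K(d)$ is the Kantorovich lifting of $d$ (the minimal $d$-cost of a coupling). The distance $\mathbf d$ is the minimal weak bisimulation metric, i.e. the pointwise infimum of all weak bisimulation metrics. *Engines.* For reals $v\le w$ and $g\in\mathbb N^+$ put $[v,w]_g=\{k\in[v,w] : k=v+h\cdot 10^{-g},\ h\in\mathbb N\}$. The engine $\mathit{Eng}_g$ has one state variable $\mathit{temp}$, one sensor $s_t$ and one actuator $\mathit{cool}$, which is on if its value is $<0$ and off if it is $\ge 0$; $\mathit{on}<0\le\mathit{off}$ are fixed real numbers. Initially $\mathit{temp}=0$, $s_t=0$ and $\mathit{cool}=\mathit{off}$.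 In each time unit $\mathit{temp}$ changes by a uniformly distributed element of $[0.6,1.4]_g$ if the cooling is off and of $[-1.4,-0.6]_g$ if it is on; $s_t$ then becomes the new temperature plus a uniformly distributed element of $[-0.1,0.1]_g$; the invariant is $0\le\mathit{temp}\le 30$. The process is $$\mathit{Ctrl}=\mathsf{fix}\,X.\ s_t?x.\ \text{if } x>10 \text{ then } \mathit{Cooling} \text{ else } \mathsf{tick}.X,$$ $$\mathit{Cooling}=\mathit{cool}!\mathit{on}.\ \mathsf{fix}\,Y.\ \mathsf{tick}^5.\ s_t?x.\ \text{if } x>10 \text{ then } \overline{\mathit{warning}}\langle \mathrm{ID}\rangle.Y \text{ else } \mathit{cool}!\mathit{off}.\mathsf{tick}.X,$$ where $\overline{\mathit{warning}}\langle \mathrm{ID}\rangle.Y$ stands for $\mathsf{fix}\,Z.\lfloor\overline{\mathit{warning}}\langle \mathrm{ID}\rangle.Y\rfloor Z$ and $\mathrm{ID}$ is an arbitrary fixed value. The variant $\widetilde{\mathit{Eng}}_g$ differs only in that active cooling changes $\mathit{temp}$ by a uniformly distributed element of $[-1.2,-0.4]_g$ (cooling power reduced by $20\%$). **Proposition.**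 For every $g\in\mathbb N^+$, $\mathit{Eng}_g\approx\widetilde{\mathit{Eng}}_g$. Moreover, the two engines are at distance $0$: $\mathbf d(\mathit{Eng}_g,\widetilde{\mathit{Eng}}_g)=0$. -/

import Mathlib

open scoped NNReal

noncomputable section

namespace PCPS

/-! ### Finite-support probability (sub-)distributions -/

/-- A finitely supported weight function. (Sub-)distributions are those of suitable total mass. -/
abbrev Weight (α : Type) : Type := α →₀ ℝ≥0

/-- The total mass, written `|γ|`. -/
def mass {α : Type} (μ : Weight α) : ℝ≥0 := μ.sum fun _ r => r

/-- The point distribution. -/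
def dirac {α : Type} (a : α) : Weight α := Finsupp.single a 1

def IsDist {α : Type} (μ : Weight α) : Prop := mass μ = 1

def IsSubDist {α : Type} (μ : Weight α) : Prop := 0 < mass μ ∧ mass μ ≤ 1

/-- The finite-support probability distributions over `α`. -/
abbrev Dist (α : Type) : Type := {μ : Weight α // IsDist μ}

/-- The image of a product of two weight functions under a binary function. -/
def map₂ {α β κ : Type} (f : α → β → κ) (μ : Weight α) (ν : Weight β) : Weight κ :=
  μ.sum fun a p => ν.sum fun b q => Finsupp.single (f a b) (p * q)

theorem mass_single {α : Type} (a : α) (r : ℝ≥0) : mass (Finsupp.single a r) = r := by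
  simp [mass]

theorem mass_mapDomain {α β : Type} (f : α → β) (μ : Weight α) :
    mass (μ.mapDomain f) = mass μ :=
  Finsupp.sum_mapDomain_index (by simp) (by simp)

theorem mass_finsum {α ι : Type} (s : Finset ι) (μ : ι → Weight α) :
    mass (∑ i ∈ s, μ i) = ∑ i ∈ s, mass (μ i) :=
  (Finsupp.sum_finsetSum_index (by simp) (by simp)).symm

theorem mass_sum {α β : Type} (μ : Weight β) (f : β → ℝ≥0 → Weight α) :
    mass (μ.sum f) = μ.sum fun b r => mass (f b r) := mass_finsum _ _

theorem mass_map₂ {α β κ : Type} (f : α → β → κ) (μ : Weight α) (ν : Weight β) :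
    mass (map₂ f μ ν) = mass μ * mass ν := by
  simp only [map₂, mass_sum, mass_single]
  simp only [mass, Finsupp.sum, Finset.sum_mul_sum]

/-! ### Values, expressions, guards -/

/-- Basic values (Booleans, integers, reals) and names. -/
inductive Value : Type
  | bool (b : Bool)
  | int (z : ℤ)
  | real (r : ℝ)
  | name (n : ℕ)

/-- The real number denoted by a numerical value. -/
def Value.num : Value → Option ℝ
  | .bool _ => none
  | .int z => some z
  | .real r => some r
  | .name _ => none

/-- A value, or a value variable (a de Bruijn index). -/
inductive Expr : Type
  | val (v : Value)
  | var (i : ℕ)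

/-- Replace variable `d` by `v`; the variables above `d` move down by one. -/
def Expr.subst (v : Value) (d : ℕ) : Expr → Expr
  | .val w => .val w
  | .var i => if i < d then .var i else if i = d then .val v else .var (i - 1)

/-- All variables are among the first `n`. -/
def Expr.Scoped (n : ℕ) : Expr → Prop
  | .val _ => True
  | .var i => i < n

/-- Boolean guards: Boolean combinations of comparisons. -/
inductive Guard : Type
  | lt (e f : Expr)
  | eq (e f : Expr)
  | neg (b : Guard)
  | conj (b c : Guard)

def Guard.subst (v : Value) (d : ℕ) : Guard → Guard
  | .lt e f => .lt (e.subst v d) (f.subst v d)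
  | .eq e f => .eq (e.subst v d) (f.subst v d)
  | .neg b => .neg (b.subst v d)
  | .conj b c => .conj (b.subst v d) (c.subst v d)

def Guard.Scoped (n : ℕ) : Guard → Prop
  | .lt e f => e.Scoped n ∧ f.Scoped n
  | .eq e f => e.Scoped n ∧ f.Scoped n
  | .neg b => b.Scoped n
  | .conj b c => b.Scoped n ∧ c.Scoped n

/-- Truth of a guard (only meaningful for closed guards). -/
def Guard.Holds : Guard → Prop
  | .lt e f => ∃ v w r s, e = .val v ∧ f = .val w ∧ v.num = some r ∧ w.num = some s ∧ r < s
  | .eq e f => ∃ v, e = .val v ∧ f = .val v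
  | .neg b => ¬ b.Holds
  | .conj b c => b.Holds ∧ c.Holds

/-! ### Processes -/

/-- Probabilities `p_i ∈ (0,1]` summing to one, over a finite nonempty index set. -/
abbrev Probs (n : ℕ) : Type := {w : Fin (n + 1) → ℝ≥0 // (∀ i, 0 < w i) ∧ ∑ i, w i = 1}

/- Processes and probabilistic choices. Channels, sensors and actuators are named by natural
numbers. Value variables and process variables are (separate) de Bruijn indices, so that
alpha-equivalent processes are equal. -/
mutual
/-- Processes. `out c e C D` and `inp c C D` are the communications with timeout
`⌊c!e.C⌋D` and `⌊c?x.C⌋D`; the latter binds a value variable in `C`, as does `read s C`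
(the sensor reading `s?x.C`). `write e a C` writes `e` on actuator `a`. `res P c` is restriction
and `fix P` is recursion, which binds a process variable in `P`. -/
inductive Proc : Type
  | nil : Proc
  | tick (C : Choice) : Proc
  | par (P Q : Proc) : Proc
  | out (c : ℕ) (e : Expr) (C D : Choice) : Proc
  | inp (c : ℕ) (C D : Choice) : Proc
  | read (s : ℕ) (C : Choice) : Proc
  | write (e : Expr) (a : ℕ) (C : Choice) : Proc
  | ite (b : Guard) (P Q : Proc) : Proc
  | res (P : Proc) (c : ℕ) : Proc
  | var (i : ℕ) : Proc
  | fix (P : Proc) : Proc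

/-- Probabilistic choice `⨁ i, p i : P i`. -/
inductive Choice : Type
  | mk (n : ℕ) (w : Probs n) (P : Fin (n + 1) → Proc) : Choice
end

/-- The one-branch choice `1 : P`. -/
def Choice.one (P : Proc) : Choice := .mk 0 ⟨fun _ => 1, by simp⟩ fun _ => P

/-- The distribution over processes denoted by a probabilistic choice. -/
def Choice.sem : Choice → Weight Proc
  | .mk _ w P => ∑ i, Finsupp.single (P i) (w.1 i)

mutual
/-- `P{v/x}`, where `x` is the value variable with index `d`. -/
def Proc.substVal (v : Value) (d : ℕ) : Proc → Proc
  | .nil => .nil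
  | .tick C => .tick (C.substVal v d)
  | .par P Q => .par (P.substVal v d) (Q.substVal v d)
  | .out c e C D => .out c (e.subst v d) (C.substVal v d) (D.substVal v d)
  | .inp c C D => .inp c (C.substVal v (d + 1)) (D.substVal v d)
  | .read s C => .read s (C.substVal v (d + 1))
  | .write e a C => .write (e.subst v d) a (C.substVal v d)
  | .ite b P Q => .ite (b.subst v d) (P.substVal v d) (Q.substVal v d)
  | .res P c => .res (P.substVal v d) c
  | .var i => .var i
  | .fix P => .fix (P.substVal v d)

def Choice.substVal (v : Value) (d : ℕ) : Choice → Choice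
  | .mk n w P => .mk n w fun i => (P i).substVal v d
end

mutual
/-- `P{R/X}`, where `X` is the process variable with index `d` and `R` is closed (so that nothing
in `R` has to be shifted). -/
def substProc (R : Proc) (d : ℕ) : Proc → Proc
  | .nil => .nil
  | .tick C => .tick (substProcC R d C)
  | .par P Q => .par (substProc R d P) (substProc R d Q)
  | .out c e C D => .out c e (substProcC R d C) (substProcC R d D)
  | .inp c C D => .inp c (substProcC R d C) (substProcC R d D)
  | .read s C => .read s (substProcC R d C)
  | .write e a C => .write e a (substProcC R d C)
  | .ite b P Q => .ite b (substProc R d P) (substProc R d Q)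
  | .res P c => .res (substProc R d P) c
  | .var i => if i < d then .var i else if i = d then R else .var (i - 1)
  | .fix P => .fix (substProc R (d + 1) P)

def substProcC (R : Proc) (d : ℕ) : Choice → Choice
  | .mk n w P => .mk n w fun i => substProc R d (P i)
end

mutual
/-- Well-formedness of a process that mentions only sensors in `S` and actuators in `A`, whose free
value variables are among the first `n` and whose free process variables are among the first `m`;
the first `b` process variables (those bound since the last time guard) may occur only
time-guarded. -/
def Proc.Wf (S A : Set ℕ) (n m b : ℕ) : Proc → Prop
  | .nil => True
  | .tick C => C.Wf S A n m 0
  | .par P Q => P.Wf S A n m b ∧ Q.Wf S A n m b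
  | .out _ e C D => e.Scoped n ∧ C.Wf S A n m b ∧ D.Wf S A n m 0
  | .inp _ C D => C.Wf S A (n + 1) m b ∧ D.Wf S A n m 0
  | .read s C => s ∈ S ∧ C.Wf S A (n + 1) m b
  | .write e a C => e.Scoped n ∧ a ∈ A ∧ C.Wf S A n m b
  | .ite g P Q => g.Scoped n ∧ P.Wf S A n m b ∧ Q.Wf S A n m b
  | .res P _ => P.Wf S A n m b
  | .var i => b ≤ i ∧ i < m
  | .fix P => P.Wf S A n (m + 1) (b + 1)

def Choice.Wf (S A : Set ℕ) (n m b : ℕ) : Choice → Prop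
  | .mk _ _ P => ∀ i, (P i).Wf S A n m b
end

/-- Labels of the untimed process transitions: internal activity, channel transmission and
reception, actuator writing and sensor reading. The label `read s` stands for `s?x`, where `x` is
the value variable `0` of the target processes. -/
inductive Label : Type
  | tau
  | out (c : ℕ) (v : Value)
  | inp (c : ℕ) (v : Value)
  | write (a : ℕ) (v : Value)
  | read (s : ℕ)

/-- `λ` is a transmission or a reception on channel `c`. -/
def Label.IsOn (c : ℕ) : Label → Prop
  | .out d _ => d = c
  | .inp d _ => d = c
  | _ => False

/-- The process transitions whose label is not `tick`. A conditional is identified with the branch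
that its guard selects, so it has the transitions of that branch. -/
inductive Proc.Step : Proc → Label → Weight Proc → Prop
  | outp (c : ℕ) (v : Value) (C D : Choice) :
      Step (.out c (.val v) C D) (.out c v) C.sem
  | inpp (c : ℕ) (v : Value) (C D : Choice) :
      Step (.inp c C D) (.inp c v) (C.substVal v 0).sem
  | write (v : Value) (a : ℕ) (C : Choice) :
      Step (.write (.val v) a C) (.write a v) C.sem
  | read (s : ℕ) (C : Choice) :
      Step (.read s C) (.read s) C.sem
  | comL {P Q : Proc} {c : ℕ} {v : Value} {π ρ : Weight Proc} :
      Step P (.out c v) π → Step Q (.inp c v) ρ → Step (.par P Q) .tau (map₂ .par π ρ)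
  | comR {P Q : Proc} {c : ℕ} {v : Value} {π ρ : Weight Proc} :
      Step P (.inp c v) π → Step Q (.out c v) ρ → Step (.par P Q) .tau (map₂ .par π ρ)
  | parL {P Q : Proc} {l : Label} {π : Weight Proc} :
      Step P l π → Step (.par P Q) l (map₂ .par π (dirac Q))
  | parR {P Q : Proc} {l : Label} {π : Weight Proc} :
      Step Q l π → Step (.par P Q) l (map₂ .par (dirac P) π)
  | res {P : Proc} {c : ℕ} {l : Label} {π : Weight Proc} :
      Step P l π → ¬ l.IsOn c → Step (.res P c) l (π.mapDomain fun R => .res R c)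
  | fix {P : Proc} {l : Label} {π : Weight Proc} :
      Step (substProc (.fix P) 0 P) l π → Step (.fix P) l π
  | iteT {b : Guard} {P Q : Proc} {l : Label} {π : Weight Proc} :
      b.Holds → Step P l π → Step (.ite b P Q) l π
  | iteF {b : Guard} {P Q : Proc} {l : Label} {π : Weight Proc} :
      ¬ b.Holds → Step Q l π → Step (.ite b P Q) l π

/-- The process transitions with label `tick`. -/
inductive Proc.Tick : Proc → Weight Proc → Prop
  | nil : Tick .nil (dirac .nil)
  | delay (C : Choice) : Tick (.tick C) C.sem
  | timeoutOut (c : ℕ) (e : Expr) (C D : Choice) : Tick (.out c e C D) D.sem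
  | timeoutInp (c : ℕ) (C D : Choice) : Tick (.inp c C D) D.sem
  | par {P Q : Proc} {π ρ : Weight Proc} :
      Tick P π → Tick Q ρ → (¬ ∃ θ, Proc.Step (.par P Q) .tau θ) →
      Tick (.par P Q) (map₂ .par π ρ)
  | res {P : Proc} {c : ℕ} {π : Weight Proc} :
      Tick P π → Tick (.res P c) (π.mapDomain fun R => .res R c)
  | fix {P : Proc} {π : Weight Proc} :
      Tick (substProc (.fix P) 0 P) π → Tick (.fix P) π
  | iteT {b : Guard} {P Q : Proc} {π : Weight Proc} :
      b.Holds → Tick P π → Tick (.ite b P Q) π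
  | iteF {b : Guard} {P Q : Proc} {π : Weight Proc} :
      ¬ b.Holds → Tick Q π → Tick (.ite b P Q) π

/-! ### Cyber-physical systems -/

/-- Physical states over the state variables `X`, sensors `S` and actuators `A`. -/
structure PhysState (X S A : Set ℕ) : Type where
  st : X → ℝ
  sens : S → ℝ
  act : A → ℝ

/-- Physical environments: evolution map, measurement map and invariant set. -/
structure PhysEnv (X S A : Set ℕ) : Type where
  evol : (X → ℝ) → (A → ℝ) → Dist (X → ℝ)
  meas : (X → ℝ) → Dist (S → ℝ)
  inv : Set (X → ℝ)

/-- The distribution over the physical states of the next time slot. -/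
def PhysEnv.next {X S A : Set ℕ} (E : PhysEnv X S A) (s : PhysState X S A) :
    Weight (PhysState X S A) :=
  (E.evol s.st s.act).1.sum fun x p => (E.meas x).1.sum fun y q =>
    Finsupp.single ⟨x, y, s.act⟩ (p * q)

/-- Systems `E;S ⋈ P`, and the deadlocked system; no well-formedness is imposed yet. -/
inductive RawCPS : Type
  | dead : RawCPS
  | sys (X S A : Set ℕ) (E : PhysEnv X S A) (s : PhysState X S A) (P : Proc) : RawCPS

/-- The process is closed, its recursions are time-guarded, and it uses only sensors and
actuators of the physical component. -/
def RawCPS.WellFormed : RawCPS → Prop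
  | .dead => True
  | .sys _ S A _ _ P => P.Wf S A 0 0 0

/-- Actions: internal activity, channel transmission and reception, passage of time. -/
inductive Act : Type
  | tau
  | out (c : ℕ) (v : Value)
  | inp (c : ℕ) (v : Value)
  | tick

/-- The system transitions whose action is not `tick`. -/
inductive RawCPS.Instant : RawCPS → Act → Weight RawCPS → Prop
  | out {X S A : Set ℕ} {E : PhysEnv X S A} {s : PhysState X S A} {P : Proc}
      {c : ℕ} {v : Value} {π : Weight Proc} :
      P.Step (.out c v) π → s.st ∈ E.inv →
      Instant (.sys X S A E s P) (.out c v) (π.mapDomain fun Q => .sys X S A E s Q)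
  | inp {X S A : Set ℕ} {E : PhysEnv X S A} {s : PhysState X S A} {P : Proc}
      {c : ℕ} {v : Value} {π : Weight Proc} :
      P.Step (.inp c v) π → s.st ∈ E.inv →
      Instant (.sys X S A E s P) (.inp c v) (π.mapDomain fun Q => .sys X S A E s Q)
  | tau {X S A : Set ℕ} {E : PhysEnv X S A} {s : PhysState X S A} {P : Proc}
      {π : Weight Proc} :
      P.Step .tau π → s.st ∈ E.inv →
      Instant (.sys X S A E s P) .tau (π.mapDomain fun Q => .sys X S A E s Q)
  | sensRead {X S A : Set ℕ} {E : PhysEnv X S A} {s : PhysState X S A} {P : Proc}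
      {k : ℕ} {π : Weight Proc} (hk : k ∈ S) :
      P.Step (.read k) π → s.st ∈ E.inv →
      Instant (.sys X S A E s P) .tau
        (π.mapDomain fun Q => .sys X S A E s (Q.substVal (.real (s.sens ⟨k, hk⟩)) 0))
  | actWrite {X S A : Set ℕ} {E : PhysEnv X S A} {s : PhysState X S A} {P : Proc}
      {a : ℕ} {v : Value} {r : ℝ} {π : Weight Proc} (ha : a ∈ A) :
      P.Step (.write a v) π → v.num = some r → s.st ∈ E.inv →
      Instant (.sys X S A E s P) .tau
        (π.mapDomain fun Q =>
          .sys X S A E ⟨s.st, s.sens, Function.update s.act ⟨a, ha⟩ r⟩ Q)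
  | deadlock {X S A : Set ℕ} {E : PhysEnv X S A} {s : PhysState X S A} {P : Proc} :
      s.st ∉ E.inv → Instant (.sys X S A E s P) .tau (dirac .dead)

/-- All system transitions. -/
inductive RawCPS.Step : RawCPS → Act → Weight RawCPS → Prop
  | instant {M : RawCPS} {α : Act} {γ : Weight RawCPS} : M.Instant α γ → Step M α γ
  | time {X S A : Set ℕ} {E : PhysEnv X S A} {s : PhysState X S A} {P : Proc}
      {π : Weight Proc} :
      P.Tick π → (¬ ∃ γ, RawCPS.Instant (.sys X S A E s P) .tau γ) → s.st ∈ E.inv →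
      Step (.sys X S A E s P) .tick (map₂ (fun s Q => .sys X S A E s Q) (E.next s) π)

/-- Cyber-physical systems: the well-formed ones, including the deadlocked one. -/
@[ext]
structure CPS : Type where
  raw : RawCPS
  wf : raw.WellFormed

def CPS.dead : CPS := ⟨.dead, trivial⟩

/-- The probabilistic labelled transition system of cyber-physical systems: the restriction of
`RawCPS.Step` to the well-formed systems (no transition is lost, see `CPS.exists_step`). -/
def CPS.Step (M : CPS) (α : Act) (γ : Weight CPS) : Prop :=
  M.raw.Step α (γ.mapDomain CPS.raw)

/-! ### Transitions preserve well-formedness -/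

theorem Expr.scoped_weaken {n n' : ℕ} (h : n ≤ n') : ∀ e : Expr, e.Scoped n → e.Scoped n'
  | .val _ => id
  | .var _ => fun hi => lt_of_lt_of_le hi h

theorem Guard.scoped_weaken {n n' : ℕ} (h : n ≤ n') : ∀ g : Guard, g.Scoped n → g.Scoped n'
  | .lt e f => And.imp (e.scoped_weaken h) (f.scoped_weaken h)
  | .eq e f => And.imp (e.scoped_weaken h) (f.scoped_weaken h)
  | .neg b => b.scoped_weaken h
  | .conj b c => And.imp (b.scoped_weaken h) (c.scoped_weaken h)

theorem Expr.scoped_subst (v : Value) {d : ℕ} : ∀ e : Expr, e.Scoped (d + 1) →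
    (e.subst v d).Scoped d
  | .val _ => id
  | .var i => fun hi => by
      have hi : i < d + 1 := hi
      simp only [Expr.subst]
      split_ifs with h1 h2
      · exact h1
      · trivial
      · omega

theorem Guard.scoped_subst (v : Value) {d : ℕ} : ∀ g : Guard, g.Scoped (d + 1) →
    (g.subst v d).Scoped d
  | .lt e f => And.imp (e.scoped_subst v) (f.scoped_subst v)
  | .eq e f => And.imp (e.scoped_subst v) (f.scoped_subst v)
  | .neg b => b.scoped_subst v
  | .conj b c => And.imp (b.scoped_subst v) (c.scoped_subst v)

mutual
theorem Proc.Wf.weaken {S A : Set ℕ} {n m b n' m' b' : ℕ} (hn : n ≤ n') (hm : m ≤ m')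
    (hb : b = m ∨ b = b') : ∀ P : Proc, P.Wf S A n m b → P.Wf S A n' m' b'
  | .nil => by simp [Proc.Wf]
  | .tick C => by
      simp only [Proc.Wf]; exact Choice.Wf.weaken hn hm (.inr rfl) C
  | .par P Q => by
      simp only [Proc.Wf]; exact And.imp (Proc.Wf.weaken hn hm hb P) (Proc.Wf.weaken hn hm hb Q)
  | .out c e C D => by
      simp only [Proc.Wf]
      exact And.imp (e.scoped_weaken hn)
        (And.imp (Choice.Wf.weaken hn hm hb C) (Choice.Wf.weaken hn hm (.inr rfl) D))
  | .inp c C D => by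
      simp only [Proc.Wf]
      exact And.imp (Choice.Wf.weaken (by omega) hm hb C) (Choice.Wf.weaken hn hm (.inr rfl) D)
  | .read s C => by
      simp only [Proc.Wf]
      exact And.imp id (Choice.Wf.weaken (by omega) hm hb C)
  | .write e a C => by
      simp only [Proc.Wf]
      exact And.imp (e.scoped_weaken hn) (And.imp id (Choice.Wf.weaken hn hm hb C))
  | .ite g P Q => by
      simp only [Proc.Wf]
      exact And.imp (g.scoped_weaken hn)
        (And.imp (Proc.Wf.weaken hn hm hb P) (Proc.Wf.weaken hn hm hb Q))
  | .res P c => by simp only [Proc.Wf]; exact Proc.Wf.weaken hn hm hb P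
  | .var i => by simp only [Proc.Wf]; omega
  | .fix P => by simp only [Proc.Wf]; exact Proc.Wf.weaken hn (by omega) (by omega) P

theorem Choice.Wf.weaken {S A : Set ℕ} {n m b n' m' b' : ℕ} (hn : n ≤ n') (hm : m ≤ m')
    (hb : b = m ∨ b = b') : ∀ C : Choice, C.Wf S A n m b → C.Wf S A n' m' b'
  | .mk _ _ P => by
      simp only [Choice.Wf]; exact fun h i => Proc.Wf.weaken hn hm hb (P i) (h i)
end

mutual
theorem Proc.Wf.substVal {S A : Set ℕ} (v : Value) {d m b : ℕ} : ∀ P : Proc,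
    P.Wf S A (d + 1) m b → (P.substVal v d).Wf S A d m b
  | .nil => by simp [Proc.Wf, Proc.substVal]
  | .tick C => by
      simp only [Proc.Wf, Proc.substVal]; exact Choice.Wf.substVal v C
  | .par P Q => by
      simp only [Proc.Wf, Proc.substVal]
      exact And.imp (Proc.Wf.substVal v P) (Proc.Wf.substVal v Q)
  | .out c e C D => by
      simp only [Proc.Wf, Proc.substVal]
      exact And.imp (e.scoped_subst v)
        (And.imp (Choice.Wf.substVal v C) (Choice.Wf.substVal v D))
  | .inp c C D => by
      simp only [Proc.Wf, Proc.substVal]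
      exact And.imp (Choice.Wf.substVal v C) (Choice.Wf.substVal v D)
  | .read s C => by
      simp only [Proc.Wf, Proc.substVal]
      exact And.imp id (Choice.Wf.substVal v C)
  | .write e a C => by
      simp only [Proc.Wf, Proc.substVal]
      exact And.imp (e.scoped_subst v) (And.imp id (Choice.Wf.substVal v C))
  | .ite g P Q => by
      simp only [Proc.Wf, Proc.substVal]
      exact And.imp (g.scoped_subst v)
        (And.imp (Proc.Wf.substVal v P) (Proc.Wf.substVal v Q))
  | .res P c => by simp only [Proc.Wf, Proc.substVal]; exact Proc.Wf.substVal v P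
  | .var i => by simp only [Proc.Wf, Proc.substVal]; exact id
  | .fix P => by simp only [Proc.Wf, Proc.substVal]; exact Proc.Wf.substVal v P

theorem Choice.Wf.substVal {S A : Set ℕ} (v : Value) {d m b : ℕ} : ∀ C : Choice,
    C.Wf S A (d + 1) m b → (C.substVal v d).Wf S A d m b
  | .mk _ _ P => by
      simp only [Choice.Wf, Choice.substVal]; exact fun h i => Proc.Wf.substVal v (P i) (h i)
end

mutual
theorem Proc.Wf.substProc {S A : Set ℕ} {R : Proc} (hR : R.Wf S A 0 0 0) {n d b c : ℕ}
    (hc : c = min b d) : ∀ P : Proc,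
    P.Wf S A n (d + 1) b → (substProc R d P).Wf S A n d c
  | .nil => by simp [Proc.Wf, PCPS.substProc]
  | .tick C => by
      simp only [Proc.Wf, PCPS.substProc]; exact Choice.Wf.substProc hR (by simp) C
  | .par P Q => by
      simp only [Proc.Wf, PCPS.substProc]
      exact And.imp (Proc.Wf.substProc hR hc P) (Proc.Wf.substProc hR hc Q)
  | .out _ e C D => by
      simp only [Proc.Wf, PCPS.substProc]
      exact And.imp id
        (And.imp (Choice.Wf.substProc hR hc C) (Choice.Wf.substProc hR (by simp) D))
  | .inp _ C D => by
      simp only [Proc.Wf, PCPS.substProc]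
      exact And.imp (Choice.Wf.substProc hR hc C) (Choice.Wf.substProc hR (by simp) D)
  | .read s C => by
      simp only [Proc.Wf, PCPS.substProc]
      exact And.imp id (Choice.Wf.substProc hR hc C)
  | .write e a C => by
      simp only [Proc.Wf, PCPS.substProc]
      exact And.imp id (And.imp id (Choice.Wf.substProc hR hc C))
  | .ite g P Q => by
      simp only [Proc.Wf, PCPS.substProc]
      exact And.imp id
        (And.imp (Proc.Wf.substProc hR hc P) (Proc.Wf.substProc hR hc Q))
  | .res P _ => by simp only [Proc.Wf, PCPS.substProc]; exact Proc.Wf.substProc hR hc P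
  | .var i => by
      simp only [Proc.Wf, PCPS.substProc]
      intro h
      split_ifs with h1 h2
      · simp only [Proc.Wf]; omega
      · exact Proc.Wf.weaken (Nat.zero_le _) (Nat.zero_le _) (.inl rfl) R hR
      · omega
  | .fix P => by
      simp only [Proc.Wf, PCPS.substProc]; exact Proc.Wf.substProc hR (by omega) P

theorem Choice.Wf.substProc {S A : Set ℕ} {R : Proc} (hR : R.Wf S A 0 0 0) {n d b c : ℕ}
    (hc : c = min b d) : ∀ C : Choice,
    C.Wf S A n (d + 1) b → (substProcC R d C).Wf S A n d c
  | .mk _ _ P => by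
      simp only [Choice.Wf, PCPS.substProcC]
      exact fun h i => Proc.Wf.substProc hR hc (P i) (h i)
end

/-- Every object of positive weight satisfies `p`. -/
def On {α : Type} (p : α → Prop) (μ : Weight α) : Prop := ∀ a ∈ μ.support, p a

theorem On.single {α : Type} {p : α → Prop} {a : α} {r : ℝ≥0} (h : p a) :
    On p (Finsupp.single a r) := by
  intro b hb
  rw [Finset.mem_singleton.1 (Finsupp.support_single_subset hb)]
  exact h

theorem On.finsum {α ι : Type} {p : α → Prop} {s : Finset ι} {μ : ι → Weight α}
    (h : ∀ i ∈ s, On p (μ i)) : On p (∑ i ∈ s, μ i) := by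
  classical
  intro b hb
  obtain ⟨i, hi, hb⟩ := Finset.mem_biUnion.1 (Finsupp.support_finsetSum hb)
  exact h i hi b hb

theorem On.sum {α β : Type} {p : α → Prop} {μ : Weight β} {f : β → ℝ≥0 → Weight α}
    (h : ∀ i ∈ μ.support, On p (f i (μ i))) : On p (μ.sum f) := On.finsum h

theorem On.map {α β : Type} {p : α → Prop} {q : β → Prop} {f : α → β} {μ : Weight α}
    (h : On p μ) (hf : ∀ a, p a → q (f a)) : On q (μ.mapDomain f) :=
  On.sum fun a ha => On.single (hf a (h a ha))

theorem On.map₂ {α β κ : Type} {p : α → Prop} {q : β → Prop} {r : κ → Prop} {f : α → β → κ}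
    {μ : Weight α} {ν : Weight β} (h : On p μ) (h' : On q ν)
    (hf : ∀ a b, p a → q b → r (f a b)) : On r (map₂ f μ ν) :=
  On.sum fun a ha => On.sum fun b hb => On.single (hf a b (h a ha) (h' b hb))

theorem Choice.Wf.sem {S A : Set ℕ} {n m b : ℕ} : ∀ {C : Choice}, C.Wf S A n m b →
    On (fun P => P.Wf S A n m b) C.sem
  | .mk _ _ P, h => by
      simp only [Choice.Wf] at h
      exact On.finsum fun i _ => On.single (h i)

/-- The number of value variables that a label leaves free. -/
def Label.free : Label → ℕ
  | .read _ => 1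
  | _ => 0

theorem Proc.Step.wf {S A : Set ℕ} {P : Proc} {l : Label} {π : Weight Proc} (h : P.Step l π)
    (hP : P.Wf S A 0 0 0) : On (fun Q => Q.Wf S A l.free 0 0) π := by
  have up : ∀ {Q : Proc} (l : Label), Q.Wf S A 0 0 0 → Q.Wf S A l.free 0 0 :=
    fun l hQ => Proc.Wf.weaken (Nat.zero_le _) le_rfl (.inl rfl) _ hQ
  induction h with
  | outp => simp only [Proc.Wf] at hP; exact hP.2.1.sem
  | inpp c v C D =>
    simp only [Proc.Wf] at hP; exact (Choice.Wf.substVal v C hP.1).sem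
  | write => simp only [Proc.Wf] at hP; exact hP.2.2.sem
  | read => simp only [Proc.Wf] at hP; exact hP.2.sem
  | comL _ _ i1 i2 =>
    simp only [Proc.Wf] at hP
    exact (i1 hP.1).map₂ (i2 hP.2) fun a b ha hb => by simp only [Proc.Wf]; exact ⟨ha, hb⟩
  | comR _ _ i1 i2 =>
    simp only [Proc.Wf] at hP
    exact (i1 hP.1).map₂ (i2 hP.2) fun a b ha hb => by simp only [Proc.Wf]; exact ⟨ha, hb⟩
  | parL _ i1 =>
    simp only [Proc.Wf] at hP
    exact (i1 hP.1).map₂ (On.single (up _ hP.2)) fun a b ha hb => by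
      simp only [Proc.Wf]; exact ⟨ha, hb⟩
  | parR _ i1 =>
    simp only [Proc.Wf] at hP
    exact (On.single (up _ hP.1)).map₂ (i1 hP.2) fun a b ha hb => by
      simp only [Proc.Wf]; exact ⟨ha, hb⟩
  | res _ _ i1 =>
    simp only [Proc.Wf] at hP
    exact (i1 hP).map fun a ha => by simp only [Proc.Wf]; exact ha
  | fix _ i1 =>
    refine i1 (Proc.Wf.substProc hP (by simp) _ (b := 1) ?_)
    simpa only [Proc.Wf] using hP
  | iteT _ _ i1 => simp only [Proc.Wf] at hP; exact i1 hP.2.1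
  | iteF _ _ i1 => simp only [Proc.Wf] at hP; exact i1 hP.2.2

theorem Proc.Tick.wf {S A : Set ℕ} {P : Proc} {π : Weight Proc} (h : P.Tick π)
    (hP : P.Wf S A 0 0 0) : On (fun Q => Q.Wf S A 0 0 0) π := by
  induction h with
  | nil => exact On.single hP
  | delay => simp only [Proc.Wf] at hP; exact hP.sem
  | timeoutOut => simp only [Proc.Wf] at hP; exact hP.2.2.sem
  | timeoutInp => simp only [Proc.Wf] at hP; exact hP.2.sem
  | par _ _ _ i1 i2 =>
    simp only [Proc.Wf] at hP
    exact (i1 hP.1).map₂ (i2 hP.2) fun a b ha hb => by simp only [Proc.Wf]; exact ⟨ha, hb⟩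
  | res _ i1 =>
    simp only [Proc.Wf] at hP
    exact (i1 hP).map fun a ha => by simp only [Proc.Wf]; exact ha
  | fix _ i1 =>
    refine i1 (Proc.Wf.substProc hP (by simp) _ (b := 1) ?_)
    simpa only [Proc.Wf] using hP
  | iteT _ _ i1 => simp only [Proc.Wf] at hP; exact i1 hP.2.1
  | iteF _ _ i1 => simp only [Proc.Wf] at hP; exact i1 hP.2.2

/-- Transitions preserve well-formedness, so that restricting them to well-formed systems
loses nothing. -/
theorem RawCPS.Step.wellFormed {M : RawCPS} {α : Act} {γ : Weight RawCPS} (h : M.Step α γ)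
    (hM : M.WellFormed) : ∀ N ∈ γ.support, N.WellFormed := by
  cases h with
  | instant h =>
    cases h with
    | out h _ => exact (h.wf hM).map fun a ha => ha
    | inp h _ => exact (h.wf hM).map fun a ha => ha
    | tau h _ => exact (h.wf hM).map fun a ha => ha
    | sensRead hk h _ => exact (h.wf hM).map fun a ha => Proc.Wf.substVal _ a ha
    | actWrite ha h _ _ => exact (h.wf hM).map fun a ha => ha
    | deadlock => exact On.single trivial
  | time h _ _ =>
    exact On.map₂ (p := fun _ => True) (fun _ _ => trivial) (h.wf hM) fun a b _ hb => hb

theorem CPS.raw_injective : Function.Injective CPS.raw := fun _ _ h => CPS.ext h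

theorem CPS.exists_step {M : CPS} {α : Act} {γ : Weight RawCPS} (h : M.raw.Step α γ) :
    ∃ γ' : Weight CPS, M.Step α γ' ∧ γ'.mapDomain CPS.raw = γ := by
  have e : (γ.comapDomain CPS.raw CPS.raw_injective.injOn).mapDomain CPS.raw = γ := by
    apply Finsupp.mapDomain_comapDomain _ CPS.raw_injective
    intro N hN
    exact ⟨⟨N, h.wellFormed M.wf N hN⟩, rfl⟩
  exact ⟨_, by rw [CPS.Step, e]; exact h, e⟩

/-! ### Transitions lead to probability distributions -/

theorem Choice.isDist_sem : ∀ C : Choice, IsDist C.sem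
  | .mk _ w P => by
      simp only [IsDist, Choice.sem, mass_finsum, mass_single]
      exact w.2.2

theorem Proc.Step.isDist {P : Proc} {l : Label} {π : Weight Proc} (h : P.Step l π) :
    IsDist π := by
  induction h with
  | outp => exact Choice.isDist_sem _
  | inpp => exact Choice.isDist_sem _
  | write => exact Choice.isDist_sem _
  | read => exact Choice.isDist_sem _
  | comL _ _ i1 i2 => simp_all [IsDist, mass_map₂]
  | comR _ _ i1 i2 => simp_all [IsDist, mass_map₂]
  | parL _ i1 => simp_all [IsDist, mass_map₂, dirac, mass_single]
  | parR _ i1 => simp_all [IsDist, mass_map₂, dirac, mass_single]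
  | res _ _ i1 => simp_all [IsDist, mass_mapDomain]
  | fix _ i1 => exact i1
  | iteT _ _ i1 => exact i1
  | iteF _ _ i1 => exact i1

theorem Proc.Tick.isDist {P : Proc} {π : Weight Proc} (h : P.Tick π) : IsDist π := by
  induction h with
  | nil => exact mass_single _ _
  | delay => exact Choice.isDist_sem _
  | timeoutOut => exact Choice.isDist_sem _
  | timeoutInp => exact Choice.isDist_sem _
  | par _ _ _ i1 i2 => simp_all [IsDist, mass_map₂]
  | res _ i1 => simp_all [IsDist, mass_mapDomain]
  | fix _ i1 => exact i1
  | iteT _ _ i1 => exact i1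
  | iteF _ _ i1 => exact i1

theorem PhysEnv.isDist_next {X S A : Set ℕ} (E : PhysEnv X S A) (s : PhysState X S A) :
    IsDist (E.next s) := by
  have h : ∀ x p, ((E.meas x).1.sum fun _ q => p * q) = p := fun x p => by
    have h := (E.meas x).2
    simp only [IsDist, mass, Finsupp.sum] at h
    rw [Finsupp.sum, ← Finset.mul_sum, h, mul_one]
  simp only [IsDist, PhysEnv.next, mass_sum, mass_single, h]
  exact (E.evol s.st s.act).2

theorem RawCPS.Step.isDist {M : RawCPS} {α : Act} {γ : Weight RawCPS} (h : M.Step α γ) :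
    IsDist γ := by
  cases h with
  | instant h =>
    cases h with
    | deadlock => exact mass_single _ _
    | out h _ => exact (mass_mapDomain _ _).trans h.isDist
    | inp h _ => exact (mass_mapDomain _ _).trans h.isDist
    | tau h _ => exact (mass_mapDomain _ _).trans h.isDist
    | sensRead hk h _ => exact (mass_mapDomain _ _).trans h.isDist
    | actWrite ha h _ _ => exact (mass_mapDomain _ _).trans h.isDist
  | time h _ _ =>
    refine (mass_map₂ _ _ _).trans ?_
    rw [show mass _ = 1 from PhysEnv.isDist_next _ _, show mass _ = 1 from h.isDist, mul_one]

theorem CPS.Step.isDist {M : CPS} {α : Act} {γ : Weight CPS} (h : M.Step α γ) : IsDist γ :=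
  (mass_mapDomain _ _).symm.trans (RawCPS.Step.isDist h)

/-! ### Weak transitions and weak probabilistic bisimilarity -/

/-- `M` moves by `α̂` to `γ`: a transition or, for `τ`, possibly no move. -/
def HatStep (α : Act) (M : CPS) (γ : Weight CPS) : Prop :=
  M.Step α γ ∨ (α = .tau ∧ γ = dirac M)

/-- The extension of `HatStep` to sub-distributions. -/
def LiftStep (α : Act) (γ γ' : Weight CPS) : Prop :=
  ∃ (n : ℕ) (p : Fin n → ℝ≥0) (M : Fin n → CPS) (J : Finset (Fin n)) (δ : Fin n → Weight CPS),
    (∀ i, 0 < p i) ∧ γ = ∑ i, p i • dirac (M i) ∧ J.Nonempty ∧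
    (∀ j ∈ J, HatStep α (M j) (δ j)) ∧ (∀ i ∉ J, ¬ ∃ ε, HatStep α (M i) ε) ∧
    γ' = ∑ j ∈ J, p j • δ j

/-- The weak `τ̂` transition between sub-distributions. -/
def WeakTau : Weight CPS → Weight CPS → Prop := Relation.ReflTransGen (LiftStep .tau)

/-- The weak `α̂` transition between sub-distributions. -/
def WeakStep (α : Act) (γ γ' : Weight CPS) : Prop :=
  (α = .tau ∧ WeakTau γ γ') ∨
  (α ≠ .tau ∧ ∃ δ ε, WeakTau γ δ ∧ LiftStep α δ ε ∧ WeakTau ε γ')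

theorem WeakStep.of_step {M : CPS} {α : Act} {γ : Weight CPS} (h : M.Step α γ) :
    WeakStep α (dirac M) γ := by
  have hl : LiftStep α (dirac M) γ :=
    ⟨1, fun _ => 1, fun _ => M, Finset.univ, fun _ => γ, by simp, by simp, by simp,
      fun _ _ => .inl h, by simp, by simp⟩
  by_cases hα : α = .tau
  · subst hα
    exact .inl ⟨rfl, .single hl⟩
  · exact .inr ⟨hα, _, _, .refl, hl, .refl⟩

/-- `ω` is a matching (coupling) for `(γ, γ')`. -/
def IsMatching (γ γ' : Weight CPS) (ω : Weight (CPS × CPS)) : Prop :=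
  ω.mapDomain Prod.fst = γ ∧ ω.mapDomain Prod.snd = γ'

def IsWeakBisimulation (R : CPS → CPS → Prop) : Prop :=
  (∀ M N, R M N → R N M) ∧
  ∀ M N, R M N → ∀ α γ, M.Step α γ →
    ∃ γ' ω, IsDist γ' ∧ IsMatching γ γ' ω ∧ WeakStep α (dirac N) γ' ∧
      ∀ M' N', 0 < ω (M', N') → R M' N'

/-- Weak probabilistic bisimilarity. -/
def Bisimilar (M N : CPS) : Prop := ∃ R, IsWeakBisimulation R ∧ R M N

/-! ### Weak bisimilarity metric -/

/-- 1-bounded pseudometrics. -/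
def IsPseudometric (d : CPS → CPS → ℝ) : Prop :=
  (∀ M N, 0 ≤ d M N ∧ d M N ≤ 1) ∧ (∀ M, d M M = 0) ∧ (∀ M N, d M N = d N M) ∧
  ∀ M N O, d M N ≤ d M O + d O N

/-- The Kantorovich lifting of `d`. -/
def kantorovich (d : CPS → CPS → ℝ) (γ γ' : Weight CPS) : ℝ :=
  sInf {r | ∃ ω, IsMatching γ γ' ω ∧ r = ω.sum fun x q => (q : ℝ) * d x.1 x.2}

def IsWeakBisimulationMetric (d : CPS → CPS → ℝ) : Prop :=
  IsPseudometric d ∧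
  ∀ M N, d M N < 1 → ∀ α γ, M.Step α γ →
    ∃ γ', IsSubDist γ' ∧ WeakStep α (dirac N) γ' ∧
      kantorovich d γ (γ' + (1 - mass γ') • dirac CPS.dead) ≤ d M N

open Classical in
/-- The discrete metric is a weak bisimulation metric; so the infimum that defines the
bisimilarity metric is over a nonempty set. -/
theorem isWeakBisimulationMetric_discrete :
    IsWeakBisimulationMetric fun M N => if M = N then 0 else 1 := by
  refine ⟨⟨fun M N => ?_, fun M => if_pos rfl, fun M N => ?_, fun M N O => ?_⟩, ?_⟩
  · dsimp only; split_ifs <;> norm_num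
  · simp only [eq_comm]
  · dsimp only
    by_cases h1 : M = O
    · subst h1; simp
    · rw [if_neg h1]; split_ifs <;> norm_num
  · intro M N hMN α γ h
    have hMN : M = N := by
      by_contra hne
      simp [hne] at hMN
    subst hMN
    have hγ : mass γ = 1 := h.isDist
    refine ⟨γ, by simp [IsSubDist, hγ], .of_step h, ?_⟩
    simp only [hγ, tsub_self, zero_smul, add_zero, if_true]
    refine csInf_le ⟨0, ?_⟩ ⟨γ.mapDomain fun M => (M, M), ⟨?_, ?_⟩, ?_⟩
    · rintro r ⟨ω, _, rfl⟩
      exact Finset.sum_nonneg fun x _ => mul_nonneg (NNReal.coe_nonneg _) (by dsimp only; split_ifs <;> norm_num)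
    · rw [← Finsupp.mapDomain_comp]; exact Finsupp.mapDomain_id
    · rw [← Finsupp.mapDomain_comp]; exact Finsupp.mapDomain_id
    · rw [Finsupp.sum_mapDomain_index (by simp) (by intros; push_cast; ring)]
      simp

/-- The weak bisimilarity metric: the pointwise infimum of all weak bisimulation metrics. -/
def bisimilarityMetric (M N : CPS) : ℝ :=
  sInf {r | ∃ d, IsWeakBisimulationMetric d ∧ d M N = r}

/-- The minimal weak bisimulation metric is the pointwise infimum. -/
theorem bisimilarityMetric_eq_of_minimal {d : CPS → CPS → ℝ} (hd : IsWeakBisimulationMetric d)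
    (hmin : ∀ e, IsWeakBisimulationMetric e → ∀ M N, d M N ≤ e M N) :
    bisimilarityMetric = d := by
  funext M N
  refine IsLeast.csInf_eq ⟨⟨d, hd, rfl⟩, ?_⟩
  rintro r ⟨e, he, rfl⟩
  exact hmin e he M N

/-- `M` and `N` have distance `p`. -/
def HasDistance (p : ℝ) (M N : CPS) : Prop := bisimilarityMetric M N = p

/-! ### The engine -/

/-- The set `[v,w]_g` of the points of `[v,w]` of the form `v + h * 10^(-g)`, with `h` in `ℕ`. -/
def gridSet (g : ℕ) (v w : ℝ) : Set ℝ :=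
  {k | k ∈ Set.Icc v w ∧ ∃ h : ℕ, k = v + h * (10 : ℝ)⁻¹ ^ g}

theorem gridSet_finite (g : ℕ) (v w : ℝ) : (gridSet g v w).Finite := by
  refine ((Set.finite_Iic ⌊(w - v) * 10 ^ g⌋₊).image
    fun h : ℕ => v + h * (10 : ℝ)⁻¹ ^ g).subset ?_
  rintro k ⟨⟨_, hk⟩, h, rfl⟩
  refine ⟨h, ?_, rfl⟩
  apply Nat.le_floor
  have h1 : (h : ℝ) * (10 : ℝ)⁻¹ ^ g ≤ w - v := by linarith
  have h2 : (0 : ℝ) < 10 ^ g := by positivity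
  calc (h : ℝ) = (h * (10 : ℝ)⁻¹ ^ g) * 10 ^ g := by
        rw [mul_assoc, ← mul_pow]; norm_num
    _ ≤ (w - v) * 10 ^ g := mul_le_mul_of_nonneg_right h1 h2.le

def grid (g : ℕ) (v w : ℝ) : Finset ℝ := (gridSet_finite g v w).toFinset

/-- The image under `f` of the uniform distribution on `[v,w]_g`. -/
def uniform {α : Type} (g : ℕ) (v w : ℝ) (f : ℝ → α) : Weight α :=
  ∑ k ∈ grid g v w, ((grid g v w).card : ℝ≥0)⁻¹ • dirac (f k)

theorem uniform_isDist {α : Type} (g : ℕ) {v w : ℝ} (h : v ≤ w) (f : ℝ → α) :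
    IsDist (uniform g v w f) := by
  have hv : v ∈ grid g v w := by
    simp only [grid, Set.Finite.mem_toFinset]
    exact ⟨⟨le_rfl, h⟩, 0, by simp⟩
  have hc : ((grid g v w).card : ℝ≥0) ≠ 0 := by
    exact_mod_cast (Finset.card_pos.2 ⟨v, hv⟩).ne'
  have hm : ∀ (s : Finset ℝ) (c : ℝ≥0), mass (∑ k ∈ s, c • dirac (f k)) = s.card * c := by
    intro s c
    have e : mass (∑ k ∈ s, c • dirac (f k)) = ∑ k ∈ s, mass (c • dirac (f k)) :=
      (Finsupp.sum_finsetSum_index (by simp) (by simp)).symm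
    rw [e]
    simp [mass, dirac]
  rw [IsDist, uniform, hm]
  exact mul_inv_cancel₀ hc

/-- The physical environment of an engine with state variable `temp`, sensor `th` and actuator
`cool`: while the cooling is off (`cool ≥ 0`) the temperature changes by a uniformly distributed
value in `[1-δ, 1+δ]_g`, while it is on (`cool < 0`) by one in `[-u-δ, -u+δ]_g`, with `δ = 0.4`;
the measurement error is uniform in `[-0.1, 0.1]_g`; the temperature has to stay in `[0,30]`. -/
def engineEnv (temp th cool : ℕ) (u : ℝ) (g : ℕ) : PhysEnv {temp} {th} {cool} where
  evol x a :=
    if 0 ≤ a ⟨cool, rfl⟩ then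
      ⟨uniform g (1 - 0.4) (1 + 0.4) fun v _ => x ⟨temp, rfl⟩ + v,
        uniform_isDist g (by norm_num) _⟩
    else
      ⟨uniform g (-u - 0.4) (-u + 0.4) fun v _ => x ⟨temp, rfl⟩ + v,
        uniform_isDist g (by linarith) _⟩
  meas x :=
    ⟨uniform g (-0.1) 0.1 fun v _ => x ⟨temp, rfl⟩ + v, uniform_isDist g (by norm_num) _⟩
  inv := {x | 0 ≤ x ⟨temp, rfl⟩ ∧ x ⟨temp, rfl⟩ ≤ 30}

/-- The initial physical state. -/
def engineState (temp th cool : ℕ) (off : ℝ) : PhysState {temp} {th} {cool} where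
  st _ := 0
  sens _ := 0
  act _ := off

/-- `tick^k.P`. -/
def tickPow : ℕ → Proc → Proc
  | 0, P => P
  | k + 1, P => .tick (.one (tickPow k P))

/-- The guard `x > 10`, where `x` is the innermost value variable. -/
def above10 : Guard := .lt (.val (.real 10)) (.var 0)

/-- The process `Cooling`, in which the process variable `0` is free. Inside the recursion on `Y`
(index `0`) that variable has index `1`; the output `warning!ID.Y` without timeout is the recursion
`fix Z. ⌊warning!ID.Y⌋Z`, inside which `Z` has index `0` and `Y` index `1`. -/
def cooling (th cool warning : ℕ) (ID : Value) (on off : ℝ) : Proc :=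
  .write (.val (.real on)) cool <| .one <| .fix <| tickPow 5 <| .read th <| .one <|
    .ite above10
      (.fix (.out warning (.val ID) (.one (.var 1)) (.one (.var 0))))
      (.write (.val (.real off)) cool <| .one <| .tick <| .one <| .var 1)

/-- The controller
`Ctrl = fix X. th?x. if x > 10 then Cooling else tick.X`, where
`Cooling = cool!on. fix Y. tick^5. th?x. if x > 10 then warning!ID.Y else cool!off.tick.X`. -/
def ctrl (th cool warning : ℕ) (ID : Value) (on off : ℝ) : Proc :=
  .fix <| .read th <| .one <|
    .ite above10 (cooling th cool warning ID on off) (.tick (.one (.var 0)))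

theorem ctrl_wf (th cool warning : ℕ) (ID : Value) (on off : ℝ) :
    (ctrl th cool warning ID on off).Wf {th} {cool} 0 0 0 := by
  simp [ctrl, cooling, tickPow, above10, Choice.one, Proc.Wf, Choice.Wf, Expr.Scoped, Guard.Scoped]

/-- An engine whose cooling has power `u`. -/
def engine (temp th cool warning : ℕ) (ID : Value) (on off : ℝ) (u : ℝ) (g : ℕ) : CPS :=
  ⟨.sys {temp} {th} {cool} (engineEnv temp th cool u g) (engineState temp th cool off)
    (ctrl th cool warning ID on off), ctrl_wf th cool warning ID on off⟩

/-- The original engine: active cooling changes the temperature by a value in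
`[-1-δ, -1+δ]_g`. -/
def Eng (temp th cool warning : ℕ) (ID : Value) (on off : ℝ) (g : ℕ) : CPS :=
  engine temp th cool warning ID on off 1 g

/-- The variant with cooling power reduced by 20%: active cooling changes the temperature by a
value in `[-0.8-δ, -0.8+δ]_g`. -/
def EngTilde (temp th cool warning : ℕ) (ID : Value) (on off : ℝ) (g : ℕ) : CPS :=
  engine temp th cool warning ID on off 0.8 g

end PCPS

end

namespace PCPS

/-! ### Product couplings -/

-- An observer could tell the engines apart only by a warning, a deadlock or a halt of time, and
-- none of these ever occurs. Cooling starts only after a reading above 10, hence at a temperature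
-- above 9.9, the measurement error being at most 0.1. The temperature is then at most 11.5, because
-- the last reading of at most 10 allowed at most 10.1, followed by one rise of at most 1.4. With
-- full or reduced power, each of the next five time units lowers the temperature by at least 0.4
-- and at most 1.4. At the following measurement it therefore lies in [2.9, 9.5], the reading is at
-- most 9.6, and the cooling is switched off without a warning. The same bounds keep the temperature
-- inside the invariant.
--
-- So both engines perform only τ and tick, and at most two τ-moves precede each tick. Systems with
-- this behaviour are equivalent whatever their probabilities: a τ is answered by staying put, a
-- tick by running to the next tick. All successors lie in one class, so the product coupling
-- suffices and the temperature distributions need not be compared.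
--
-- The class is `IsEngine`, which covers every cooling power between 0.8 and 1 and so contains both
-- engines. `Stage.step`, `Stage.tick` and `Stage.progress` carry the case analysis behind
-- `isSimulationClass_isEngine`; `IsSimulationClass.bisimilar` and
-- `IsSimulationClass.hasDistance_zero` derive the two claims from it.

theorem On.of_mapDomain {α β : Type} {f : α → β} (hf : f.Injective) {p : β → Prop} {μ : Weight α}
    (h : On p (μ.mapDomain f)) : On (fun a => p (f a)) μ := fun a ha =>
  h (f a) (by rwa [Finsupp.mem_support_iff, Finsupp.mapDomain_apply hf, ← Finsupp.mem_support_iff])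

theorem mapDomain_fst_map₂ {α β : Type} (μ : Weight α) {ν : Weight β} (hν : IsDist ν) :
    (map₂ Prod.mk μ ν).mapDomain Prod.fst = μ := by
  have h : ∑ b ∈ ν.support, ν b = 1 := hν
  simp only [map₂, Finsupp.sum, Finsupp.mapDomain_finsetSum, Finsupp.mapDomain_single]
  simp only [← Finsupp.single_finsetSum, ← Finset.mul_sum, h, mul_one]
  exact Finsupp.sum_single μ

theorem mapDomain_snd_map₂ {α β : Type} {μ : Weight α} (hμ : IsDist μ) (ν : Weight β) :
    (map₂ Prod.mk μ ν).mapDomain Prod.snd = ν := by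
  have h : ∑ a ∈ μ.support, μ a = 1 := hμ
  simp only [map₂, Finsupp.sum, Finsupp.mapDomain_finsetSum, Finsupp.mapDomain_single]
  rw [Finset.sum_comm]
  simp only [← Finsupp.single_finsetSum, ← Finset.sum_mul, h, one_mul]
  exact Finsupp.sum_single ν

/-- The independent coupling is enough because all pairs of members of a class are related, so it
does not matter how the masses are paired. -/
theorem isMatching_map₂ {γ γ' : Weight CPS} (h : IsDist γ) (h' : IsDist γ') :
    IsMatching γ γ' (map₂ Prod.mk γ γ') :=
  ⟨mapDomain_fst_map₂ γ h', mapDomain_snd_map₂ h γ'⟩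

/-- A single coupling of cost zero bounds the infimum. Nonnegativity of `d` serves to bound the set
of costs from below, as `csInf_le` requires. -/
theorem kantorovich_nonpos {d : CPS → CPS → ℝ} (hd : ∀ M N, 0 ≤ d M N) {γ γ' : Weight CPS}
    {ω : Weight (CPS × CPS)} (hω : IsMatching γ γ' ω) (h0 : On (fun x => d x.1 x.2 = 0) ω) :
    kantorovich d γ γ' ≤ 0 := by
  refine csInf_le ⟨0, ?_⟩ ⟨ω, hω, ?_⟩
  · rintro r ⟨ω', _, rfl⟩
    exact Finset.sum_nonneg fun x _ => mul_nonneg (NNReal.coe_nonneg _) (hd _ _)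
  · exact (Finset.sum_eq_zero fun x hx => mul_eq_zero_of_right _ (h0 x hx)).symm

/-! ### Classes of mutually simulating systems -/

/-- Every transition of a member of the class stays in the class, and each member of the class
can answer it by a weak transition that also stays in the class. -/
def IsSimulationClass (G : CPS → Prop) : Prop :=
  ∀ M, G M → ∀ α γ, M.Step α γ → On G γ ∧
    ∀ N, G N → ∃ γ', IsDist γ' ∧ WeakStep α (dirac N) γ' ∧ On G γ'

theorem IsSimulationClass.bisimilar {G : CPS → Prop} (hG : IsSimulationClass G) {M N : CPS}
    (hM : G M) (hN : G N) : Bisimilar M N := by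
  refine ⟨fun M N => G M ∧ G N, ⟨fun _ _ => And.symm, ?_⟩, hM, hN⟩
  rintro M N ⟨hM, hN⟩ α γ h
  obtain ⟨hγ, hN'⟩ := hG M hM α γ h
  obtain ⟨γ', hd, hw, hγ'⟩ := hN' N hN
  refine ⟨γ', _, hd, isMatching_map₂ h.isDist hd, hw, fun M' N' hpos => ?_⟩
  exact On.map₂ (r := fun x : CPS × CPS => G x.1 ∧ G x.2) hγ hγ'
    (fun _ _ => And.intro) (M', N') (Finsupp.mem_support_iff.2 hpos.ne')

open Classical in
-- This is the discrete metric after all members of `G` have been identified; the triangle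
-- inequality is transitivity of "equal or both in `G`". A distance below 1 is 0, so the answering
-- coupling must have cost 0.
theorem IsSimulationClass.isWeakBisimulationMetric {G : CPS → Prop} (hG : IsSimulationClass G) :
    IsWeakBisimulationMetric fun M N => if M = N ∨ (G M ∧ G N) then 0 else 1 := by
  have hnn : ∀ M N, (0 : ℝ) ≤ if M = N ∨ (G M ∧ G N) then 0 else 1 := fun M N => by
    split_ifs <;> norm_num
  refine ⟨⟨fun M N => ⟨hnn M N, ?_⟩, fun M => if_pos (.inl rfl), fun M N => ?_,
    fun M N O => ?_⟩, ?_⟩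
  · dsimp only; split_ifs <;> norm_num
  · simp only [eq_comm, and_comm]
  · dsimp only
    by_cases h1 : M = O ∨ (G M ∧ G O)
    · by_cases h2 : O = N ∨ (G O ∧ G N)
      · have h3 : M = N ∨ (G M ∧ G N) := by
          rcases h1 with rfl | h1
          · exact h2
          · rcases h2 with rfl | h2
            · exact .inr h1
            · exact .inr ⟨h1.1, h2.2⟩
        rw [if_pos h1, if_pos h2, if_pos h3, add_zero]
      · rw [if_neg h2, if_pos h1]; split_ifs <;> norm_num
    · rw [if_neg h1]
      have := hnn O N
      split_ifs <;> norm_num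
  · intro M N hMN α γ h
    have hr : M = N ∨ (G M ∧ G N) := by
      by_contra hne
      simp [hne] at hMN
    dsimp only
    rw [if_pos hr]
    have hγ : mass γ = 1 := h.isDist
    rcases hr with rfl | ⟨hM, hN⟩
    -- Equal systems, possibly outside `G`, answer with the same transition and the diagonal
    -- coupling. All answers have mass 1, so no mass is moved to the dead system.
    · refine ⟨γ, by simp [IsSubDist, hγ], .of_step h, ?_⟩
      simp only [hγ, tsub_self, zero_smul, add_zero]
      refine kantorovich_nonpos hnn (ω := γ.mapDomain fun M => (M, M)) ⟨?_, ?_⟩ ?_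
      · rw [← Finsupp.mapDomain_comp]; exact Finsupp.mapDomain_id
      · rw [← Finsupp.mapDomain_comp]; exact Finsupp.mapDomain_id
      · exact On.map (p := fun _ => True) (fun _ _ => trivial) fun M _ => if_pos (.inl rfl)
    · obtain ⟨hγG, hN'⟩ := hG M hM α γ h
      obtain ⟨γ', hd, hw, hγ'⟩ := hN' N hN
      have hd' : mass γ' = 1 := hd
      refine ⟨γ', by simp [IsSubDist, hd'], hw, ?_⟩
      simp only [hd', tsub_self, zero_smul, add_zero]
      exact kantorovich_nonpos hnn (isMatching_map₂ h.isDist hd)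
        (On.map₂ hγG hγ' fun _ _ ha hb => if_pos (.inr ⟨ha, hb⟩))

theorem IsSimulationClass.hasDistance_zero {G : CPS → Prop} (hG : IsSimulationClass G)
    {M N : CPS} (hM : G M) (hN : G N) : HasDistance 0 M N := by
  refine IsLeast.csInf_eq ⟨⟨_, hG.isWeakBisimulationMetric, if_pos (.inr ⟨hM, hN⟩)⟩, ?_⟩
  rintro r ⟨e, he, rfl⟩
  exact (he.1.1 M N).1

/-! ### Weak transitions through Dirac steps -/

theorem LiftStep.of_step {M : CPS} {α : Act} {γ : Weight CPS} (h : M.Step α γ) :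
    LiftStep α (dirac M) γ :=
  ⟨1, fun _ => 1, fun _ => M, Finset.univ, fun _ => γ, by simp, by simp, by simp,
    fun _ _ => .inl h, by simp, by simp⟩

/-- A weak step for any action begins with a weak τ phase, which absorbs one more τ. -/
theorem WeakStep.head {M : CPS} {α : Act} {γ γ' : Weight CPS} (h : M.Step .tau γ)
    (h' : WeakStep α γ γ') : WeakStep α (dirac M) γ' := by
  rcases h' with ⟨hα, h'⟩ | ⟨hα, δ, ε, h1, h2, h3⟩
  · exact .inl ⟨hα, .head (.of_step h) h'⟩
  · exact .inr ⟨hα, δ, ε, .head (.of_step h) h1, h2, h3⟩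

/-! ### Inversion of process transitions -/

theorem Choice.sem_one (P : Proc) : (Choice.one P).sem = dirac P := by
  simp [Choice.one, Choice.sem, dirac]

theorem Choice.substVal_one (v : Value) (d : ℕ) (P : Proc) :
    (Choice.one P).substVal v d = .one (P.substVal v d) := by
  simp [Choice.one, Choice.substVal]

theorem substProcC_one (R : Proc) (d : ℕ) (P : Proc) :
    substProcC R d (.one P) = .one (substProc R d P) := by
  simp [Choice.one, substProcC]

theorem Proc.step_tick_iff {C : Choice} {l : Label} {π : Weight Proc} :
    Step (.tick C) l π ↔ False :=
  ⟨(by cases ·), False.elim⟩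

theorem Proc.step_read_iff {s : ℕ} {C : Choice} {l : Label} {π : Weight Proc} :
    Step (.read s C) l π ↔ l = .read s ∧ π = C.sem :=
  ⟨fun h => by cases h; exact ⟨rfl, rfl⟩, by rintro ⟨rfl, rfl⟩; exact .read s C⟩

theorem Proc.step_write_iff {v : Value} {a : ℕ} {C : Choice} {l : Label} {π : Weight Proc} :
    Step (.write (.val v) a C) l π ↔ l = .write a v ∧ π = C.sem :=
  ⟨fun h => by cases h; exact ⟨rfl, rfl⟩, by rintro ⟨rfl, rfl⟩; exact .write v a C⟩

theorem Proc.step_fix_iff {P : Proc} {l : Label} {π : Weight Proc} :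
    Step (.fix P) l π ↔ Step (substProc (.fix P) 0 P) l π :=
  ⟨fun h => by cases h; assumption, .fix⟩

theorem Proc.step_ite_iff {b : Guard} {P Q : Proc} {l : Label} {π : Weight Proc} :
    Step (.ite b P Q) l π ↔ (b.Holds ∧ Step P l π) ∨ (¬ b.Holds ∧ Step Q l π) :=
  ⟨fun h => by
    cases h with
    | iteT hb h => exact .inl ⟨hb, h⟩
    | iteF hb h => exact .inr ⟨hb, h⟩, by
    rintro (⟨hb, h⟩ | ⟨hb, h⟩)
    · exact .iteT hb h
    · exact .iteF hb h⟩

theorem Proc.tick_tick_iff {C : Choice} {π : Weight Proc} :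
    Tick (.tick C) π ↔ π = C.sem :=
  ⟨fun h => by cases h; rfl, by rintro rfl; exact .delay C⟩

theorem Proc.tick_fix_iff {P : Proc} {π : Weight Proc} :
    Tick (.fix P) π ↔ Tick (substProc (.fix P) 0 P) π :=
  ⟨fun h => by cases h; assumption, .fix⟩

theorem Proc.tick_ite_iff {b : Guard} {P Q : Proc} {π : Weight Proc} :
    Tick (.ite b P Q) π ↔ (b.Holds ∧ Tick P π) ∨ (¬ b.Holds ∧ Tick Q π) :=
  ⟨fun h => by
    cases h with
    | iteT hb h => exact .inl ⟨hb, h⟩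
    | iteF hb h => exact .inr ⟨hb, h⟩, by
    rintro (⟨hb, h⟩ | ⟨hb, h⟩)
    · exact .iteT hb h
    · exact .iteF hb h⟩

theorem Guard.holds_lt_real_iff {r s : ℝ} :
    (Guard.lt (.val (.real r)) (.val (.real s))).Holds ↔ r < s := by
  simp [Guard.Holds, Value.num]

/-! ### Inversion of system transitions -/

/-- The invariant excludes the deadlock. The first case records neither action nor target, since for
engines it only has to be refuted. -/
theorem RawCPS.Instant.of_inv {X S A : Set ℕ} {E : PhysEnv X S A} {s : PhysState X S A}
    {P : Proc} {α : Act} {γ : Weight RawCPS} (h : Instant (.sys X S A E s P) α γ)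
    (hs : s.st ∈ E.inv) :
    (∃ l π, P.Step l π ∧ (l = .tau ∨ (∃ c v, l = .out c v) ∨ ∃ c v, l = .inp c v)) ∨
    (α = .tau ∧ ∃ k, ∃ hk : k ∈ S, ∃ π, P.Step (.read k) π ∧
      γ = π.mapDomain fun Q => .sys X S A E s (Q.substVal (.real (s.sens ⟨k, hk⟩)) 0)) ∨
    (α = .tau ∧ ∃ a, ∃ ha : a ∈ A, ∃ v r π, P.Step (.write a v) π ∧ v.num = some r ∧
      γ = π.mapDomain fun Q =>
        .sys X S A E ⟨s.st, s.sens, Function.update s.act ⟨a, ha⟩ r⟩ Q) := by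
  cases h with
  | out h _ => exact .inl ⟨_, _, h, .inr (.inl ⟨_, _, rfl⟩)⟩
  | inp h _ => exact .inl ⟨_, _, h, .inr (.inr ⟨_, _, rfl⟩)⟩
  | tau h _ => exact .inl ⟨_, _, h, .inl rfl⟩
  | sensRead hk h _ => exact .inr (.inl ⟨rfl, _, hk, _, h, rfl⟩)
  | actWrite ha h hv _ => exact .inr (.inr ⟨rfl, _, ha, _, _, _, h, hv, rfl⟩)
  | deadlock h => exact absurd hs h

/-! ### Evolution of the engine -/

theorem On.uniform {α : Type} {p : α → Prop} {g : ℕ} {v w : ℝ} {f : ℝ → α}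
    (h : ∀ k, v ≤ k → k ≤ w → p (f k)) : On p (uniform g v w f) := by
  refine On.finsum fun k hk => ?_
  have hk : k ∈ gridSet g v w := (gridSet_finite g v w).mem_toFinset.1 hk
  rw [dirac, Finsupp.smul_single]
  exact On.single (h k hk.1.1 hk.1.2)

/-- The predicate `q` takes the newly drawn state as an argument because the measurement is made
after the evolution. -/
theorem PhysEnv.on_next {X S A : Set ℕ} {E : PhysEnv X S A} {s : PhysState X S A}
    {p : (X → ℝ) → Prop} {q : (X → ℝ) → (S → ℝ) → Prop} (hp : On p (E.evol s.st s.act).1)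
    (hq : ∀ x, On (q x) (E.meas x).1) :
    On (fun t => p t.st ∧ q t.st t.sens ∧ t.act = s.act) (E.next s) :=
  On.sum fun x hx => On.sum fun y hy => On.single ⟨hp x hx, hq x y hy, rfl⟩

section Engine

variable {temp th cool : ℕ}

abbrev PhysState.temperature (s : PhysState {temp} {th} {cool}) : ℝ := s.st ⟨temp, rfl⟩

abbrev PhysState.reading (s : PhysState {temp} {th} {cool}) : ℝ := s.sens ⟨th, rfl⟩

abbrev PhysState.cooler (s : PhysState {temp} {th} {cool}) : ℝ := s.act ⟨cool, rfl⟩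

/-- The sensor reading is within the measurement error. -/
def PhysState.Accurate (s : PhysState {temp} {th} {cool}) : Prop :=
  s.temperature - 0.1 ≤ s.reading ∧ s.reading ≤ s.temperature + 0.1

theorem engineEnv_next_off {u : ℝ} {g : ℕ} {s : PhysState {temp} {th} {cool}}
    (hs : 0 ≤ s.cooler) :
    On (fun t => t.Accurate ∧ t.cooler = s.cooler ∧ s.temperature + 0.6 ≤ t.temperature ∧
      t.temperature ≤ s.temperature + 1.4) ((engineEnv temp th cool u g).next s) := by
  intro t ht
  obtain ⟨h1, h2, h3⟩ := PhysEnv.on_next (E := engineEnv temp th cool u g) (s := s)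
    (p := fun x => s.temperature + 0.6 ≤ x ⟨temp, rfl⟩ ∧ x ⟨temp, rfl⟩ ≤ s.temperature + 1.4)
    (q := fun x y => x ⟨temp, rfl⟩ - 0.1 ≤ y ⟨th, rfl⟩ ∧ y ⟨th, rfl⟩ ≤ x ⟨temp, rfl⟩ + 0.1)
    (by
      simp only [engineEnv, if_pos hs]
      exact On.uniform fun k _ _ => by constructor <;> linarith)
    (fun x => On.uniform fun k _ _ => by constructor <;> linarith) t ht
  exact ⟨h2, congrFun h3 _, h1⟩

/-- The range is common to all admissible powers: `-u - 0.4` is smallest at `u = 1`, and `-u + 0.4`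
is largest at `u = 0.8`. From here on the argument no longer sees the value of `u`. -/
theorem engineEnv_next_on {u : ℝ} (hu : 0.8 ≤ u) (hu' : u ≤ 1) {g : ℕ}
    {s : PhysState {temp} {th} {cool}} (hs : s.cooler < 0) :
    On (fun t => t.Accurate ∧ t.cooler = s.cooler ∧ s.temperature - 1.4 ≤ t.temperature ∧
      t.temperature ≤ s.temperature - 0.4) ((engineEnv temp th cool u g).next s) := by
  intro t ht
  obtain ⟨h1, h2, h3⟩ := PhysEnv.on_next (E := engineEnv temp th cool u g) (s := s)
    (p := fun x => s.temperature - 1.4 ≤ x ⟨temp, rfl⟩ ∧ x ⟨temp, rfl⟩ ≤ s.temperature - 0.4)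
    (q := fun x y => x ⟨temp, rfl⟩ - 0.1 ≤ y ⟨th, rfl⟩ ∧ y ⟨th, rfl⟩ ≤ x ⟨temp, rfl⟩ + 0.1)
    (by
      simp only [engineEnv, if_neg (not_le.2 hs)]
      exact On.uniform fun k _ _ => by constructor <;> linarith)
    (fun x => On.uniform fun k _ _ => by constructor <;> linarith) t ht
  exact ⟨h2, congrFun h3 _, h1⟩

/-! ### The stages of the controller -/

variable (th cool : ℕ) (warning : ℕ) (ID : Value) (on off : ℝ)

/-- The test of the temperature after five units of cooling, with guard `b`; `Y` stands inside the
recursion of the warning. -/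
def coolingTest (b : Guard) (Y X : Proc) : Proc :=
  .ite b (.fix (.out warning (.val ID) (.one Y) (.one (.var 0))))
    (.write (.val (.real off)) cool (.one (.tick (.one X))))

/-- The recursion on `Y`, with the controller in place of `X`. -/
def coolingLoop : Proc :=
  .fix (tickPow 5 (.read th (.one (coolingTest cool warning ID off above10 (.var 1)
    (ctrl th cool warning ID on off)))))

/-- The measurement that follows five units of cooling. -/
def coolingRead : Proc :=
  .read th (.one (coolingTest cool warning ID off above10
    (coolingLoop th cool warning ID on off) (ctrl th cool warning ID on off)))

variable {th cool warning ID on off}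

theorem ctrl_substVal (v : Value) (d : ℕ) :
    (ctrl th cool warning ID on off).substVal v d = ctrl th cool warning ID on off := by
  simp [ctrl, cooling, tickPow, above10, Proc.substVal, Choice.substVal_one, Expr.subst,
    Guard.subst]

theorem ctrl_substProc (R : Proc) (d : ℕ) :
    substProc R d (ctrl th cool warning ID on off) = ctrl th cool warning ID on off := by
  simp [ctrl, cooling, tickPow, substProc, substProcC_one]

theorem coolingLoop_substVal (v : Value) (d : ℕ) :
    (coolingLoop th cool warning ID on off).substVal v d =
      coolingLoop th cool warning ID on off := by
  simp [coolingLoop, coolingTest, tickPow, above10, Proc.substVal, Choice.substVal_one,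
    Expr.subst, Guard.subst, ctrl_substVal]

/-- The existential hides the body of the recursion, so that rewriting unfolds only the outermost
layer and leaves inner copies of the controller folded. -/
theorem ctrl_unfold :
    ∃ P, ctrl th cool warning ID on off = .fix P ∧ substProc (.fix P) 0 P =
      .read th (.one (.ite above10
        (.write (.val (.real on)) cool (.one (coolingLoop th cool warning ID on off)))
        (.tick (.one (ctrl th cool warning ID on off))))) := by
  refine ⟨_, rfl, ?_⟩
  simp [ctrl, cooling, coolingLoop, coolingTest, tickPow, substProc, substProcC_one]

theorem coolingLoop_unfold :
    ∃ P, coolingLoop th cool warning ID on off = .fix P ∧ substProc (.fix P) 0 P =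
      tickPow 5 (coolingRead th cool warning ID on off) := by
  refine ⟨_, rfl, ?_⟩
  simp [coolingRead, coolingLoop, coolingTest, tickPow, substProc, substProcC_one,
    ctrl_substProc]

theorem step_ctrl_iff {l : Label} {π : Weight Proc} :
    (ctrl th cool warning ID on off).Step l π ↔ l = .read th ∧ π = dirac (.ite above10
        (.write (.val (.real on)) cool (.one (coolingLoop th cool warning ID on off)))
        (.tick (.one (ctrl th cool warning ID on off)))) := by
  obtain ⟨P, h1, h2⟩ := ctrl_unfold (th := th) (cool := cool) (warning := warning) (ID := ID)
    (on := on) (off := off)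
  -- The first `h1` also rewrites the controller inside the target; the last one does the same to
  -- the copy introduced by `h2`, so that both sides agree.
  rw [h1, Proc.step_fix_iff, h2, Proc.step_read_iff, Choice.sem_one, h1]

theorem tick_ctrl_iff {π : Weight Proc} :
    (ctrl th cool warning ID on off).Tick π ↔ False := by
  obtain ⟨P, h1, h2⟩ := ctrl_unfold (th := th) (cool := cool) (warning := warning) (ID := ID)
    (on := on) (off := off)
  rw [h1, Proc.tick_fix_iff, h2]
  exact ⟨(by cases ·), False.elim⟩

theorem step_coolingLoop_iff {l : Label} {π : Weight Proc} :
    (coolingLoop th cool warning ID on off).Step l π ↔ False := by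
  obtain ⟨P, h1, h2⟩ := coolingLoop_unfold (th := th) (cool := cool) (warning := warning)
    (ID := ID) (on := on) (off := off)
  rw [h1, Proc.step_fix_iff, h2, tickPow, Proc.step_tick_iff]

theorem tick_coolingLoop_iff {π : Weight Proc} :
    (coolingLoop th cool warning ID on off).Tick π ↔
      π = dirac (tickPow 4 (coolingRead th cool warning ID on off)) := by
  obtain ⟨P, h1, h2⟩ := coolingLoop_unfold (th := th) (cool := cool) (warning := warning)
    (ID := ID) (on := on) (off := off)
  rw [h1, Proc.tick_fix_iff, h2, tickPow, Proc.tick_tick_iff, Choice.sem_one]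

variable (th cool warning ID on off) in
/-- The reachable combinations of physical state and process. The natural number bounds the number
of instantaneous transitions before the next time step. -/
inductive Stage (s : PhysState {temp} {th} {cool}) : ℕ → Proc → Prop
  -- The bound is 11.5 = 10 + 0.1 + 1.4: threshold, measurement error, largest rise.
  | start : 0 ≤ s.temperature → s.temperature ≤ 11.5 → 0 ≤ s.cooler →
      Stage s 2 (ctrl th cool warning ID on off)
  | test : 0 ≤ s.temperature → s.temperature ≤ 11.5 → 0 ≤ s.cooler →
      Stage s 1 (.ite (.lt (.val (.real 10)) (.val (.real s.reading)))
        (.write (.val (.real on)) cool (.one (coolingLoop th cool warning ID on off)))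
        (.tick (.one (ctrl th cool warning ID on off))))
  | loop : 9.9 ≤ s.temperature → s.temperature ≤ 11.5 → s.cooler < 0 →
      Stage s 0 (coolingLoop th cool warning ID on off)
  -- With `k + 1` of the five units left, `4 - k` have passed, each lowering the temperature by
  -- between 0.4 and 1.4.
  | cool (k : ℕ) : k < 4 → 9.9 - 1.4 * (4 - k) ≤ s.temperature →
      s.temperature ≤ 11.5 - 0.4 * (4 - k) → s.cooler < 0 →
      Stage s 0 (tickPow (k + 1) (coolingRead th cool warning ID on off))
  -- After all five units: 2.9 = 9.9 - 5 · 1.4 and 9.5 = 11.5 - 5 · 0.4.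
  | measure : 2.9 ≤ s.temperature → s.temperature ≤ 9.5 → s.cooler < 0 →
      Stage s 2 (coolingRead th cool warning ID on off)
  | retest : 2.9 ≤ s.temperature → s.temperature ≤ 9.5 → s.cooler < 0 →
      Stage s 1 (coolingTest cool warning ID off
        (.lt (.val (.real 10)) (.val (.real s.reading)))
        (coolingLoop th cool warning ID on off) (ctrl th cool warning ID on off))
  | rest : 2.9 ≤ s.temperature → s.temperature ≤ 9.5 → 0 ≤ s.cooler →
      Stage s 0 (.tick (.one (ctrl th cool warning ID on off)))

theorem Stage.temperature_mem {s : PhysState {temp} {th} {cool}} {n : ℕ} {P : Proc}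
    (h : Stage th cool warning ID on off s n P) : 0 ≤ s.temperature ∧ s.temperature ≤ 30 := by
  cases h with
  | cool k hk h1 h2 _ =>
    have hk' : (k : ℝ) + 1 ≤ 4 := by exact_mod_cast hk
    have : (0 : ℝ) ≤ k := k.cast_nonneg
    constructor <;> linarith
  | _ => constructor <;> linarith

/-- Reading and writing leave the temperature alone, so its bounds carry over, and the counter drops
each time. No other label occurs because the warning branch is never selected. -/
theorem Stage.step {s : PhysState {temp} {th} {cool}} {n : ℕ} {P : Proc}
    (h : Stage th cool warning ID on off s n P) (hs : s.Accurate) (hon : on < 0) (hoff : 0 ≤ off)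
    {l : Label} {π : Weight Proc} (hl : P.Step l π) :
    ∃ Q, ∃ m < n, π = dirac Q ∧
      ((l = .read th ∧ Stage th cool warning ID on off s m (Q.substVal (.real s.reading) 0)) ∨
        ∃ r, l = .write cool (.real r) ∧ Stage th cool warning ID on off
          ⟨s.st, s.sens, Function.update s.act ⟨cool, rfl⟩ r⟩ m Q) := by
  have up : ∀ r, PhysState.cooler (⟨s.st, s.sens, Function.update s.act ⟨cool, rfl⟩ r⟩ :
      PhysState {temp} {th} {cool}) = r := fun r => Function.update_self ..
  cases h with
  | start h1 h2 h3 =>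
    obtain ⟨rfl, rfl⟩ := step_ctrl_iff.1 hl
    refine ⟨_, 1, by norm_num, rfl, .inl ⟨rfl, ?_⟩⟩
    simpa [Proc.substVal, Choice.substVal_one, above10, Guard.subst, Expr.subst, ctrl_substVal,
      coolingLoop_substVal] using Stage.test h1 h2 h3
  | test h1 h2 h3 =>
    rw [Proc.step_ite_iff, Guard.holds_lt_real_iff, Proc.step_write_iff, Proc.step_tick_iff,
      Choice.sem_one] at hl
    obtain ⟨hx, rfl, rfl⟩ | ⟨_, ⟨⟩⟩ := hl
    refine ⟨_, 0, by norm_num, rfl, .inr ⟨on, rfl, .loop ?_ h2 ((up on).trans_lt hon)⟩⟩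
    -- The reading exceeds 10 by at most the error, so the temperature is above 9.9.
    have := hs.2
    change 9.9 ≤ s.temperature
    linarith
  | loop => exact (step_coolingLoop_iff.1 hl).elim
  | cool k => exact (Proc.step_tick_iff.1 hl).elim
  | measure h1 h2 h3 =>
    rw [coolingRead, Proc.step_read_iff, Choice.sem_one] at hl
    obtain ⟨rfl, rfl⟩ := hl
    refine ⟨_, 1, by norm_num, rfl, .inl ⟨rfl, ?_⟩⟩
    simpa [coolingTest, Proc.substVal, Choice.substVal_one, above10, Guard.subst, Expr.subst,
      ctrl_substVal, coolingLoop_substVal] using Stage.retest h1 h2 h3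
  | retest h1 h2 h3 =>
    rw [coolingTest, Proc.step_ite_iff, Guard.holds_lt_real_iff, Proc.step_write_iff,
      Choice.sem_one] at hl
    -- At a temperature of at most 9.5 the reading is at most 9.6, which contradicts the guard of
    -- the warning branch.
    have := hs.2
    obtain ⟨hx, -⟩ | ⟨_, rfl, rfl⟩ := hl
    · linarith
    · exact ⟨_, 0, by norm_num, rfl, .inr ⟨off, rfl, .rest h1 h2 (hoff.trans_eq (up off).symm)⟩⟩
  | rest => exact (Proc.step_tick_iff.1 hl).elim

/-- The next temperature ranges over a whole interval determined by the state of the cooler, so the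
statement holds for every admissible power at once. -/
theorem Stage.tick {s : PhysState {temp} {th} {cool}} {n : ℕ} {P : Proc}
    (h : Stage th cool warning ID on off s n P) (hs : s.Accurate)
    {π : Weight Proc} (hπ : P.Tick π) :
    ∃ Q, π = dirac Q ∧
      ((0 ≤ s.cooler ∧ ∀ t : PhysState {temp} {th} {cool}, t.cooler = s.cooler →
          s.temperature + 0.6 ≤ t.temperature → t.temperature ≤ s.temperature + 1.4 →
          ∃ m, Stage th cool warning ID on off t m Q) ∨
        (s.cooler < 0 ∧ ∀ t : PhysState {temp} {th} {cool}, t.cooler = s.cooler →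
          s.temperature - 1.4 ≤ t.temperature → t.temperature ≤ s.temperature - 0.4 →
          ∃ m, Stage th cool warning ID on off t m Q)) := by
  cases h with
  | start => exact (tick_ctrl_iff.1 hπ).elim
  | test h1 h2 h3 =>
    rw [Proc.tick_ite_iff, Guard.holds_lt_real_iff, Proc.tick_tick_iff, Choice.sem_one] at hπ
    obtain ⟨_, h⟩ | ⟨hx, rfl⟩ := hπ
    · cases h
    -- A reading of at most 10 means a temperature of at most 10.1, hence at most 11.5 after the
    -- rise.
    · refine ⟨_, rfl, .inl ⟨h3, fun t ht h4 h5 => ⟨2, .start ?_ ?_ (h3.trans_eq ht.symm)⟩⟩⟩ <;>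
        linarith [hs.1]
  | loop h1 h2 h3 =>
    rw [tick_coolingLoop_iff] at hπ
    -- One unit has passed and four remain, which is `k = 3`.
    refine ⟨_, hπ, .inr ⟨h3, fun t ht h4 h5 =>
      ⟨0, .cool 3 (by norm_num) ?_ ?_ (ht.trans_lt h3)⟩⟩⟩ <;> push_cast <;> linarith
  | cool k hk h1 h2 h3 =>
    rw [tickPow, Proc.tick_tick_iff, Choice.sem_one] at hπ
    refine ⟨_, hπ, .inr ⟨h3, fun t ht h4 h5 => ?_⟩⟩
    cases k with
    | zero =>
      simp only [Nat.cast_zero] at h1 h2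
      exact ⟨2, .measure (by linarith) (by linarith) (ht.trans_lt h3)⟩
    | succ k =>
      push_cast at h1 h2
      exact ⟨0, .cool k (by omega) (by linarith) (by linarith) (ht.trans_lt h3)⟩
  | measure => cases hπ
  | retest =>
    rw [coolingTest, Proc.tick_ite_iff, Guard.holds_lt_real_iff] at hπ
    have := hs.2
    obtain ⟨hx, -⟩ | ⟨_, h⟩ := hπ
    · linarith
    · cases h
  | rest h1 h2 h3 =>
    rw [Proc.tick_tick_iff, Choice.sem_one] at hπ
    refine ⟨_, hπ, .inl ⟨h3, fun t ht h4 h5 =>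
      ⟨2, .start ?_ ?_ (h3.trans_eq ht.symm)⟩⟩⟩ <;> linarith

/-- This rules out a time stop: a blocked state could not answer the tick of another member of the
class. -/
theorem Stage.progress {s : PhysState {temp} {th} {cool}} {n : ℕ} {P : Proc}
    (h : Stage th cool warning ID on off s n P) (hs : s.Accurate) :
    (∃ l π, P.Step l π) ∨ ∃ π, P.Tick π := by
  cases h with
  | start => exact .inl ⟨_, _, step_ctrl_iff.2 ⟨rfl, rfl⟩⟩
  | test =>
    simp only [Proc.step_ite_iff, Proc.tick_ite_iff, Guard.holds_lt_real_iff,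
      Proc.step_write_iff, Proc.step_tick_iff, Proc.tick_tick_iff]
    by_cases hx : 10 < s.reading
    · exact .inl ⟨_, _, .inl ⟨hx, rfl, rfl⟩⟩
    · exact .inr ⟨_, .inr ⟨hx, rfl⟩⟩
  | loop => exact .inr ⟨_, tick_coolingLoop_iff.2 rfl⟩
  | cool => exact .inr ⟨_, .delay _⟩
  | measure => exact .inl ⟨_, _, .read _ _⟩
  | retest =>
    refine .inl ⟨_, _, .iteF ?_ (.write _ _ _)⟩
    rw [Guard.holds_lt_real_iff]
    have := hs.2
    linarith
  | rest => exact .inr ⟨_, .delay _⟩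

/-! ### The class of all engine states -/

variable (temp th cool warning ID on off) in
/-- The system is an engine of cooling power between `0.8` and `1` in a reachable state, with at
most `n` instantaneous transitions before the next time step. -/
inductive EngineStage (g n : ℕ) : RawCPS → Prop
  | mk (u : ℝ) (s : PhysState {temp} {th} {cool}) (P : Proc) : 0.8 ≤ u → u ≤ 1 → s.Accurate →
      Stage th cool warning ID on off s n P →
      EngineStage g n (.sys {temp} {th} {cool} (engineEnv temp th cool u g) s P)

variable (temp th cool warning ID on off) in
/-- The system is an engine of cooling power between `0.8` and `1` in a reachable state. -/
def IsEngine (g : ℕ) (M : RawCPS) : Prop := ∃ n, EngineStage temp th cool warning ID on off g n M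

theorem isEngine_engine {u : ℝ} {g : ℕ} (hoff : 0 ≤ off) (hu : 0.8 ≤ u) (hu' : u ≤ 1) :
    IsEngine temp th cool warning ID on off g
      (engine temp th cool warning ID on off u g).raw :=
  ⟨2, .mk u _ _ hu hu' (by norm_num [PhysState.Accurate, engineState])
    (.start le_rfl (by norm_num [engineState]) hoff)⟩

/-- Instantaneous moves have point targets, so τ-chains can be followed one system at a time; the
decreasing bound makes them finite. -/
theorem EngineStage.instant {g n : ℕ} {M : RawCPS} (hon : on < 0) (hoff : 0 ≤ off)
    (h : EngineStage temp th cool warning ID on off g n M) {α : Act} {γ : Weight RawCPS}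
    (hγ : M.Instant α γ) :
    α = .tau ∧ ∃ N, ∃ m < n, γ = dirac N ∧ EngineStage temp th cool warning ID on off g m N := by
  obtain ⟨u, s, P, hu, hu', hs, hP⟩ := h
  rcases hγ.of_inv hP.temperature_mem with ⟨l, π, hl, hl'⟩ | ⟨rfl, k, hk, π, hl, rfl⟩ |
    ⟨rfl, a, ha, v, r, π, hl, hv, rfl⟩
  · obtain ⟨Q, m, hm, rfl, ⟨rfl, -⟩ | ⟨r, rfl, -⟩⟩ := hP.step hs hon hoff hl <;> simp at hl'
  · obtain ⟨Q, m, hm, rfl, ⟨hk', hQ⟩ | ⟨r, hr, -⟩⟩ := hP.step hs hon hoff hl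
    · cases hk'
      exact ⟨rfl, _, m, hm, Finsupp.mapDomain_single, .mk u s _ hu hu' hs hQ⟩
    · cases hr
  · obtain ⟨Q, m, hm, rfl, ⟨hk', -⟩ | ⟨r', hr, hQ⟩⟩ := hP.step hs hon hoff hl
    · cases hk'
    · cases hr
      cases hv
      -- Writing the actuator changes neither temperature nor reading, so `hs` still proves accuracy
      -- of the new state.
      exact ⟨rfl, _, m, hm, Finsupp.mapDomain_single, .mk u _ _ hu hu' hs hQ⟩

theorem IsEngine.step {g : ℕ} {M : RawCPS} (hon : on < 0) (hoff : 0 ≤ off)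
    (h : IsEngine temp th cool warning ID on off g M) {α : Act} {γ : Weight RawCPS}
    (hγ : M.Step α γ) :
    (α = .tau ∨ α = .tick) ∧ On (IsEngine temp th cool warning ID on off g) γ := by
  obtain ⟨n, h⟩ := h
  cases hγ with
  | instant hγ =>
    obtain ⟨rfl, N, m, -, rfl, hN⟩ := h.instant hon hoff hγ
    exact ⟨.inl rfl, On.single ⟨m, hN⟩⟩
  | time hπ hn hinv =>
    refine ⟨.inr rfl, ?_⟩
    obtain ⟨u, s, P, hu, hu', hs, hP⟩ := h
    obtain ⟨Q, rfl, ⟨ha, hQ⟩ | ⟨ha, hQ⟩⟩ := hP.tick hs hπ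
    · refine On.map₂ (engineEnv_next_off ha) (On.single (p := (· = Q)) rfl) ?_
      rintro t _ ⟨h1, h2, h3, h4⟩ rfl
      obtain ⟨m, hm⟩ := hQ t h2 h3 h4
      exact ⟨m, .mk u t _ hu hu' h1 hm⟩
    · refine On.map₂ (engineEnv_next_on hu hu' ha) (On.single (p := (· = Q)) rfl) ?_
      rintro t _ ⟨h1, h2, h3, h4⟩ rfl
      obtain ⟨m, hm⟩ := hQ t h2 h3 h4
      exact ⟨m, .mk u t _ hu hu' h1 hm⟩

theorem EngineStage.progress {g n : ℕ} {M : RawCPS} (hon : on < 0) (hoff : 0 ≤ off)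
    (h : EngineStage temp th cool warning ID on off g n M) :
    (∃ N, ∃ m < n, M.Step .tau (dirac N) ∧ EngineStage temp th cool warning ID on off g m N) ∨
      ∃ γ, M.Step .tick γ := by
  have hM := h
  obtain ⟨u, s, P, hu, hu', hs, hP⟩ := h
  have hinv : s.st ∈ (engineEnv temp th cool u g).inv := hP.temperature_mem
  -- Time may pass only when no τ is possible, so the absence of τ is exactly what the tick
  -- transition needs.
  by_cases hi : ∃ γ, RawCPS.Instant (.sys {temp} {th} {cool} (engineEnv temp th cool u g) s P)
      .tau γ
  · obtain ⟨γ, hγ⟩ := hi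
    obtain ⟨-, N, m, hm, rfl, hN⟩ := hM.instant hon hoff hγ
    exact .inl ⟨N, m, hm, .instant hγ, hN⟩
  · rcases hP.progress hs with ⟨l, π, hl⟩ | ⟨π, hπ⟩
    -- An untimed process step is a reading or a writing and would give the system a τ, against
    -- `hi`.
    · obtain ⟨Q, m, hm, rfl, ⟨rfl, hQ⟩ | ⟨r, rfl, hQ⟩⟩ := hP.step hs hon hoff hl
      · exact (hi ⟨_, .sensRead (Set.mem_singleton th) hl hinv⟩).elim
      · exact (hi ⟨_, .actWrite (Set.mem_singleton cool) hl rfl hinv⟩).elim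
    · exact .inr ⟨_, .time hπ hi hinv⟩

/-- Strong induction on the bound: either a τ leads to a single system with a smaller bound, or the
tick is available at once. -/
theorem EngineStage.exists_weakStep_tick {g : ℕ} (hon : on < 0) (hoff : 0 ≤ off) (n : ℕ) :
    ∀ M : CPS, EngineStage temp th cool warning ID on off g n M.raw →
      ∃ γ, IsDist γ ∧ WeakStep .tick (dirac M) γ ∧
        On (fun N => IsEngine temp th cool warning ID on off g N.raw) γ := by
  induction n using Nat.strong_induction_on with
  | _ n ih =>
    intro M hM
    rcases hM.progress hon hoff with ⟨N, m, hm, hN, hN'⟩ | ⟨γ, hγ⟩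
    · have hwf : N.WellFormed := hN.wellFormed M.wf N (by simp [dirac])
      obtain ⟨γ, h1, h2, h3⟩ := ih m hm ⟨N, hwf⟩ hN'
      refine ⟨γ, h1, h2.head ?_, h3⟩
      rw [CPS.Step, dirac, Finsupp.mapDomain_single]
      exact hN
    · obtain ⟨γ', hγ', rfl⟩ := CPS.exists_step hγ
      exact ⟨γ', hγ'.isDist, .of_step hγ',
        On.of_mapDomain CPS.raw_injective (IsEngine.step hon hoff ⟨n, hM⟩ hγ).2⟩

variable (temp th cool warning ID off) in
-- A τ needs no answer, since the responder already belongs to the class; a tick is answered by the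
-- responder's own next tick, whatever its distribution.
theorem isSimulationClass_isEngine (hon : on < 0) (hoff : 0 ≤ off) (g : ℕ) :
    IsSimulationClass fun M => IsEngine temp th cool warning ID on off g M.raw := by
  intro M hM α γ hγ
  obtain ⟨hα, hG⟩ := hM.step hon hoff hγ
  refine ⟨On.of_mapDomain CPS.raw_injective hG, fun N hN => ?_⟩
  rcases hα with rfl | rfl
  · exact ⟨dirac N, mass_single _ _, .inl ⟨rfl, .refl⟩, On.single hN⟩
  · obtain ⟨n, hN⟩ := hN
    exact EngineStage.exists_weakStep_tick hon hoff n N hN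

end Engine

end PCPS

theorem mainTheorem8 (temp th cool warning : ℕ) (ID : PCPS.Value) (on off : ℝ)
    (hon : on < 0) (hoff : 0 ≤ off) (g : ℕ+) :
    PCPS.Bisimilar (PCPS.Eng temp th cool warning ID on off g)
        (PCPS.EngTilde temp th cool warning ID on off g) ∧
      PCPS.HasDistance 0 (PCPS.Eng temp th cool warning ID on off g)
        (PCPS.EngTilde temp th cool warning ID on off g) := by
  have hM : PCPS.IsEngine temp th cool warning ID on off g
      (PCPS.Eng temp th cool warning ID on off g).raw :=
    PCPS.isEngine_engine hoff (by norm_num) le_rfl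
  have hN : PCPS.IsEngine temp th cool warning ID on off g
      (PCPS.EngTilde temp th cool warning ID on off g).raw :=
    PCPS.isEngine_engine hoff le_rfl (by norm_num)
  have hG := PCPS.isSimulationClass_isEngine temp th cool warning ID off hon hoff g
  exact ⟨hG.bisimilar hM hN, hG.hasDistance_zero hM hN⟩
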